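/- Let $\alpha>-1/2$. Let $G_k^{(\alpha)}$ be the Gegenbauer polynomial of degree $k$ with parameter $\alpha$, normalized by $G_k^{(\alpha)}(1)=1$, and for $l>0$ let $G_{l,k}^{(\alpha)}(x)=G_k^{(\alpha)}(2x/l-1)$ be the shifted Gegenbauer polynomial on $[0,l]$. For $n\ge 0$ let $x_0<\dots<x_n$ be the zeros of $G_{l,n+1}^{(\alpha)}$ and let $L_0,\dots,L_n$ be the Lagrange interpolating polynomials at these nodes. For $0\le i\le n$ the first-order (barycentric) shifted Gegenbauer quadrature approximates $\int_0^{x_i}f(x)\,dx$ by $\sum_{j=0}^n f(x_j)\int_0^{x_i}L_j(x)\,dx$, and its truncation error is $$E_{1,l,n}^{(\alpha)}=\int_0^{x_i}f(x)\,dx-\sum_{j=0}^n f(x_j)\int_0^{x_i}L_j(x)\,dx .$$ Suppose that $f\in C^{n+1}[0,l]$ and $\sup_{0\le x\le l}|f^{(n+1)}(x)|\le A$, where $A>0$. Then the following hold for all $i=0,\dots,n$. 1. If $\alpha\ge 0$ and $n\ge 0$, then $$|E_{1,l,n}^{(\alpha)}|\le \frac{A\,2^{-2n-1}\,\Gamma(\alpha+1)\,x_i\,l^{n+1}\,\Gamma(n+2\alpha+1)}{\Gamma(2\alpha+1)\,\Gamma(n+2)\,\Gamma(n+\alpha+1)}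 .$$ If $-1/2<\alpha<0$ and $n$ is odd, then $$|E_{1,l,n}^{(\alpha)}|\le \frac{A\,2^{-2n-1}\,\Gamma(\alpha+1)\,x_i\,l^{n+1}\,\Gamma(n+2\alpha+1)}{\Gamma(2\alpha+1)\,\Gamma(n+2)\,\Gamma(n+\alpha+1)}\cdot\frac{(n+1)!\,|\Gamma(2\alpha)|}{\Gamma(n+2\alpha+1)}\left|\binom{\frac{n+1}{2}+\alpha-1}{\frac{n+1}{2}}\right| .$$ If $-1/2<\alpha<0$ and $n\ge0$ is even, then $$|E_{1,l,n}^{(\alpha)}|< \frac{A\,2^{-2n-1}\,|\Gamma(\alpha)|\,|\alpha|\,x_i\,l^{n+1}}{\sqrt{(n+1)(2\alpha+n+1)}\;\Gamma(n+\alpha+1)}\left|\binom{\frac n2+\alpha}{\frac n2}\right| .$$ 2. There are positive constants $D_1^{(\alpha)},D_2^{(\alpha)}$ and an integer $N$, depending only on $\alpha$, such that, with $B_1^{(\alpha)}=A\,D_1^{(\alpha)}$ and $B_2^{(\alpha)}=B_1^{(\alpha)}D_2^{(\alpha)}$, for all $n\ge N$, $$|E_{1,l,n}^{(\alpha)}|\le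 B_1^{(\alpha)}\frac{e^n\,l^{n+1}\,x_i}{2^{2n+1}\,n^{n+3/2-\alpha}}\quad\text{if }\alpha\ge 0,\qquad |E_{1,l,n}^{(\alpha)}|\le B_2^{(\alpha)}\frac{e^n\,l^{n+1}\,x_i}{2^{2n+1}\,n^{n+3/2}}\quad\text{if }-\tfrac12<\alpha<0 .$$ 3. In particular the error decays exponentially: for every $l>0$ there are $c>0$ and $\rho\in(0,1)$, depending only on $\alpha$ and $l$, such that $|E_{1,l,n}^{(\alpha)}|\le A\,c\,\rho^n$ for all $n\ge0$ and all $f$ and $A$ as above. Here $\binom{z}{k}=z(z-1)\cdots(z-k+1)/k!$ for real $z$ and integers $k\ge0$. -/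

import Mathlib

open Polynomial

noncomputable section

/-- The Gegenbauer polynomials with parameter `α > -1/2`, in the standardization with value `1`
at the point `1` (so that `α = 0` gives the Chebyshev polynomials of the first kind and `α = 1/2`
the Legendre polynomials), by their three-term recurrence
`(j + 2α) G_{j+1}(x) = 2 (j + α) x G_j(x) - j G_{j-1}(x)` for `j ≥ 1`. -/
def gegenbauer (α : ℝ) : ℕ → ℝ[X]
  | 0 => 1
  | 1 => X
  | j + 2 =>
      C (((j : ℝ) + 1 + 2 * α)⁻¹) *
        (C (2 * ((j : ℝ) + 1 + α)) * X * gegenbauer α (j + 1) - C ((j : ℝ) + 1) * gegenbauer α j)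

/-- The shifted Gegenbauer polynomial on `[0, l]`, namely `x ↦ G_k (2 x / l - 1)`. -/
def shiftedGegenbauer (l α : ℝ) (k : ℕ) : ℝ[X] :=
  (gegenbauer α k).comp (C (2 / l) * X - 1)

/-- The zeros of the shifted Gegenbauer polynomial of degree `n + 1`, in increasing order. -/
def sggNodeList (l α : ℝ) (n : ℕ) : List ℝ :=
  (shiftedGegenbauer l α (n + 1)).roots.toFinset.sort (· ≤ ·)

/-- The shifted Gegenbauer-Gauss node `x_i`, for `i = 0, …, n`: the `i`-th zero, in increasing
order, of the shifted Gegenbauer polynomial of degree `n + 1`. -/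
def sggNode (l α : ℝ) (n : ℕ) (i : Fin (n + 1)) : ℝ :=
  (sggNodeList l α n).getD i 0

/-- The first-order shifted Gegenbauer integration matrix: the entry `(i, j)` is the integral over
`[0, x_i]` of the `j`-th Lagrange polynomial for the shifted Gegenbauer-Gauss nodes. (The
barycentric formula is a way to evaluate this same polynomial.) -/
def bsgim (l α : ℝ) (n : ℕ) (i j : Fin (n + 1)) : ℝ :=
  ∫ x in (0 : ℝ)..sggNode l α n i, (Lagrange.basis Finset.univ (sggNode l α n) j).eval x

/-- The barycentric shifted Gegenbauer quadrature for the integral of `f` over `[0, x_i]`. -/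
def bsgq (l α : ℝ) (n : ℕ) (f : ℝ → ℝ) (i : Fin (n + 1)) : ℝ :=
  ∑ j, bsgim l α n i j * f (sggNode l α n j)

/-- The truncation error of the quadrature at the node `x_i`. -/
def bsgqError (l α : ℝ) (n : ℕ) (f : ℝ → ℝ) (i : Fin (n + 1)) : ℝ :=
  (∫ x in (0 : ℝ)..sggNode l α n i, f x) - bsgq l α n f i

/-- `f` is of class `C^{n+1}` on `[0, l]`, and its derivative of order `n + 1` (one-sided at the
end points) is bounded by `A` there. -/
def DerivBound (l : ℝ) (n : ℕ) (f : ℝ → ℝ) (A : ℝ) : Prop :=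
  ContDiffOn ℝ (n + 1 : ℕ) f (Set.Icc 0 l) ∧
    ∀ x ∈ Set.Icc 0 l, |iteratedDerivWithin (n + 1) f (Set.Icc 0 l) x| ≤ A

end

/-! The quadrature integrates the interpolant of `f` exactly, so its error is the integral of the
interpolation error, which is pointwise at most `A / (n + 1)!` times the modulus of the nodal
polynomial (`abs_sub_interpolate_le`). The nodes are the zeros of the shifted Gegenbauer polynomial,
so the nodal polynomial is that polynomial divided by its leading coefficient
(`eval_nodal_sggNode`). Everything reduces to the maximum of |G_{n+1}| on [-1, 1].

That maximum is controlled by the Sonine function S = G² + (1 - x²) G'² / ((n+1)(2α+n+1)), which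
dominates G². By the differential equation, S' is a nonnegative multiple of α x. For α ≥ 0 the
maximum of S is at ±1, where S = 1. For α < 0 it is at 0, where one of the two terms vanishes by
parity, and the other is a generalized binomial coefficient times Gamma factors.

For large n, Γ(n+s+1) is comparable to n^s n! (`Gamma_natCast_add_bounds`). All powers except n^(max
α 0) / n then cancel, a factor 1/n! is left, and a Stirling lower bound for n! gives the stated
rate. The factorial beats every geometric sequence, hence exponential decay for every l. -/

/-! ### Algebra of the Gegenbauer polynomials: derivatives, end values, leading coefficient. -/

theorem gegenbauer_recurrence {α : ℝ} (hα : -1 / 2 < α) (n : ℕ) :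
    C ((n : ℝ) + 1 + 2 * α) * gegenbauer α (n + 2) =
      C (2 * ((n : ℝ) + 1 + α)) * X * gegenbauer α (n + 1) - C ((n : ℝ) + 1) * gegenbauer α n := by
  have h : (n : ℝ) + 1 + 2 * α ≠ 0 := by
    have : (0 : ℝ) ≤ n := n.cast_nonneg
    linarith
  rw [gegenbauer, ← mul_assoc, ← C_mul, mul_inv_cancel₀ h, C_1, one_mul]

theorem gegenbauer_eval_recurrence {α : ℝ} (hα : -1 / 2 < α) (n : ℕ) (x : ℝ) :
    ((n : ℝ) + 1 + 2 * α) * (gegenbauer α (n + 2)).eval x =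
      2 * ((n : ℝ) + 1 + α) * x * (gegenbauer α (n + 1)).eval x
        - ((n : ℝ) + 1) * (gegenbauer α n).eval x := by
  simpa using congrArg (eval x) (gegenbauer_recurrence hα n)

/-- The three relations need each other in the induction. The differentiated recurrence plus the old
first relation gives the new second; this with the recurrence and the old third gives the new first;
eliminating G_{n+1}' between the new first and second gives the new third after cancelling n + 1 +
2α > 0. In the base case that factor is 2α, which may vanish, so it is checked directly. -/
theorem gegenbauer_derivative_relations {α : ℝ} (hα : -1 / 2 < α) (n : ℕ) :
    C ((n : ℝ) + 2 * α) * (X * derivative (gegenbauer α (n + 1))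
        - C ((n : ℝ) + 1) * gegenbauer α (n + 1)) = C ((n : ℝ) + 1) * derivative (gegenbauer α n) ∧
    C ((n : ℝ) + 2 * α) * derivative (gegenbauer α (n + 1)) =
      C ((n : ℝ) + 1) * (X * derivative (gegenbauer α n) + C ((n : ℝ) + 2 * α) * gegenbauer α n) ∧
    (1 - X ^ 2) * derivative (gegenbauer α (n + 1)) =
      C ((n : ℝ) + 1) * (gegenbauer α n - X * gegenbauer α (n + 1)) := by
  induction n with
  | zero => simp [gegenbauer]; ring
  | succ n ih =>
    obtain ⟨h1, h2, h3⟩ := ih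
    have hne : (C ((n : ℝ) + 1 + 2 * α) : ℝ[X]) ≠ 0 := by
      rw [Ne, C_eq_zero]
      have : (0 : ℝ) ≤ n := n.cast_nonneg
      linarith
    have hr := gegenbauer_recurrence hα n
    have hd := congrArg derivative hr
    simp only [derivative_mul, derivative_sub, derivative_C, derivative_X, zero_mul, zero_add,
      mul_one] at hd
    simp only [Nat.cast_add, Nat.cast_one, map_add, map_mul, C_1, map_ofNat] at *
    have h2' : (C (n : ℝ) + 1 + 2 * C α) * derivative (gegenbauer α (n + 1 + 1)) =
        (C (n : ℝ) + 1 + 1) * (X * derivative (gegenbauer α (n + 1))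
          + (C (n : ℝ) + 1 + 2 * C α) * gegenbauer α (n + 1)) := by
      linear_combination hd + h1
    have h1' : (C (n : ℝ) + 1 + 2 * C α) * (X * derivative (gegenbauer α (n + 1 + 1))
        - (C (n : ℝ) + 1 + 1) * gegenbauer α (n + 1 + 1)) =
        (C (n : ℝ) + 1 + 1) * derivative (gegenbauer α (n + 1)) := by
      linear_combination X * h2' - (C (n : ℝ) + 1 + 1) * hr - (C (n : ℝ) + 1 + 1) * h3
    refine ⟨h1', h2', mul_left_cancel₀ hne ?_⟩
    linear_combination h2' - X * h1'

theorem gegenbauer_eval_derivative {α : ℝ} (hα : -1 / 2 < α) (n : ℕ) (x : ℝ) :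
    (1 - x ^ 2) * (derivative (gegenbauer α (n + 1))).eval x =
      ((n : ℝ) + 1) * ((gegenbauer α n).eval x - x * (gegenbauer α (n + 1)).eval x) := by
  simpa using congrArg (eval x) (gegenbauer_derivative_relations hα n).2.2

/-- The differential equation of the Gegenbauer polynomials. -/
theorem gegenbauer_ode {α : ℝ} (hα : -1 / 2 < α) (n : ℕ) (x : ℝ) :
    (1 - x ^ 2) * (derivative (derivative (gegenbauer α (n + 1)))).eval x =
      (2 * α + 1) * x * (derivative (gegenbauer α (n + 1))).eval x
        - ((n : ℝ) + 1) * (2 * α + n + 1) * (gegenbauer α (n + 1)).eval x := by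
  obtain ⟨h1, -, h3⟩ := gegenbauer_derivative_relations hα n
  have h1 := congrArg (eval x) h1
  have h3 := congrArg (eval x) (congrArg derivative h3)
  simp at h1 h3
  linear_combination h3 - h1

/-- At x = 1 the factor 1 - x² kills the derivative, so consecutive polynomials agree there. -/
theorem gegenbauer_eval_one {α : ℝ} (hα : -1 / 2 < α) (n : ℕ) :
    (gegenbauer α n).eval 1 = 1 := by
  cases n with
  | zero => simp [gegenbauer]
  | succ n =>
    induction n with
    | zero => simp [gegenbauer]
    | succ n ih =>
      have h := gegenbauer_eval_derivative hα (n + 1) 1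
      have h0 : ((n + 1 : ℕ) : ℝ) + 1 ≠ 0 := by positivity
      have := (mul_eq_zero.1 (h.symm.trans (by norm_num))).resolve_left h0
      linarith

theorem gegenbauer_eval_neg_one {α : ℝ} (hα : -1 / 2 < α) (n : ℕ) :
    (gegenbauer α n).eval (-1) = (-1) ^ n := by
  cases n with
  | zero => simp [gegenbauer]
  | succ n =>
    induction n with
    | zero => simp [gegenbauer]
    | succ n ih =>
      have h := gegenbauer_eval_derivative hα (n + 1) (-1)
      have h0 : ((n + 1 : ℕ) : ℝ) + 1 ≠ 0 := by positivity
      have := (mul_eq_zero.1 (h.symm.trans (by norm_num))).resolve_left h0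
      rw [pow_succ, ← ih]
      linarith

theorem gegenbauer_natDegree_le (α : ℝ) (n : ℕ) : (gegenbauer α n).natDegree ≤ n := by
  induction n using Nat.twoStepInduction with
  | zero => simp [gegenbauer]
  | one => simp [gegenbauer]
  | more n ih0 ih1 =>
    rw [gegenbauer]
    refine natDegree_C_mul_le _ _ |>.trans ((natDegree_sub_le _ _).trans (max_le ?_ ?_))
    · rw [mul_assoc]
      refine natDegree_C_mul_le _ _ |>.trans ?_
      rw [add_comm n 2]
      exact natDegree_mul_le_of_le (natDegree_X_le) ih1 |>.trans (by omega)
    · exact (natDegree_C_mul_le _ _).trans (by omega)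

/-- The leading coefficient of the Gegenbauer polynomial of degree `n + 1`. -/
noncomputable def gegenbauerLead (α : ℝ) (n : ℕ) : ℝ :=
  2 ^ n * Real.Gamma (n + α + 1) * Real.Gamma (2 * α + 1)
    / (Real.Gamma (n + 2 * α + 1) * Real.Gamma (α + 1))

theorem gegenbauerLead_pos {α : ℝ} (hα : -1 / 2 < α) (n : ℕ) : 0 < gegenbauerLead α n := by
  have hn : (0 : ℝ) ≤ n := n.cast_nonneg
  have h1 := Real.Gamma_pos_of_pos (s := n + α + 1) (by linarith)
  have h2 := Real.Gamma_pos_of_pos (s := 2 * α + 1) (by linarith)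
  have h3 := Real.Gamma_pos_of_pos (s := n + 2 * α + 1) (by linarith)
  have h4 := Real.Gamma_pos_of_pos (s := α + 1) (by linarith)
  unfold gegenbauerLead
  positivity

theorem gegenbauer_coeff {α : ℝ} (hα : -1 / 2 < α) (n : ℕ) :
    (gegenbauer α (n + 1)).coeff (n + 1) = gegenbauerLead α n := by
  have h2 := (Real.Gamma_pos_of_pos (s := 2 * α + 1) (by linarith)).ne'
  have h4 := (Real.Gamma_pos_of_pos (s := α + 1) (by linarith)).ne'
  induction n with
  | zero => simp [gegenbauer, gegenbauerLead, mul_comm (Real.Gamma (α + 1)), h2, h4]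
  | succ n ih =>
    have hn : (0 : ℝ) ≤ n := n.cast_nonneg
    have hne : (n : ℝ) + 1 + 2 * α ≠ 0 := by linarith
    have h := congrArg (fun p => coeff p (n + 1 + 1)) (gegenbauer_recurrence hα n)
    simp only [coeff_sub, coeff_C_mul, mul_assoc, coeff_X_mul, ih] at h
    rw [coeff_eq_zero_of_natDegree_lt (p := gegenbauer α n)
      ((gegenbauer_natDegree_le α n).trans_lt (by omega)), mul_zero, sub_zero] at h
    refine mul_left_cancel₀ hne (h.trans ?_)
    have e1 : Real.Gamma (n + 2 * α + 1 + 1) = _ :=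
      Real.Gamma_add_one (s := n + 2 * α + 1) (by linarith)
    have e2 : Real.Gamma (n + α + 1 + 1) = _ :=
      Real.Gamma_add_one (s := n + α + 1) (by linarith)
    have h3 := (Real.Gamma_pos_of_pos (s := n + 2 * α + 1) (by linarith)).ne'
    have h5 : (n : ℝ) + 2 * α + 1 ≠ 0 := by linarith
    unfold gegenbauerLead
    push_cast
    rw [show (n : ℝ) + 1 + α + 1 = n + α + 1 + 1 by ring,
      show (n : ℝ) + 1 + 2 * α + 1 = n + 2 * α + 1 + 1 by ring, e1, e2]
    field_simp
    ring

/-! ### Simple real zeros, interlacing, and the quadrature nodes. -/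

/-- A polynomial is determined by its leading coefficient and its distinct zeros. -/
theorem eq_C_mul_nodal {p : ℝ[X]} {n : ℕ} (hp : p.natDegree ≤ n) {z : Fin n → ℝ}
    (hz : Function.Injective z) (h0 : ∀ i, p.eval (z i) = 0) :
    p = C (p.coeff n) * Lagrange.nodal Finset.univ z := by
  refine eq_of_degree_sub_lt_of_eval_index_eq (s := Finset.univ) (v := z) hz.injOn ?_ ?_
  · rw [Finset.card_univ, Fintype.card_fin, degree_lt_iff_coeff_zero]
    have hd : (Lagrange.nodal Finset.univ z).natDegree = n := by simp [Lagrange.natDegree_nodal]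
    intro m hm
    rcases hm.eq_or_lt with rfl | hm
    · have := Lagrange.nodal_monic (s := Finset.univ) (v := z)
      rw [Monic, leadingCoeff, hd] at this
      simp [this]
    · simp [coeff_eq_zero_of_natDegree_lt (hp.trans_lt hm),
        coeff_eq_zero_of_natDegree_lt (hd.trans_lt hm)]
  · intro i _
    simp [h0 i, Lagrange.eval_nodal_at_node]

/-- The sign of a product of linear factors with increasing zeros, between two of the zeros. -/
theorem neg_one_pow_mul_prod_pos {n k : ℕ} (hk : k ≤ n) {z : ℕ → ℝ} {x : ℝ}
    (hlt : ∀ i < k, z i < x) (hgt : ∀ i, k ≤ i → i < n → x < z i) :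
    0 < (-1) ^ (n - k) * ∏ i ∈ Finset.range n, (x - z i) := by
  rw [← Finset.prod_range_mul_prod_Ico _ hk]
  have h1 : ∏ i ∈ Finset.Ico k n, (x - z i) = (-1) ^ (n - k) * ∏ i ∈ Finset.Ico k n, (z i - x) := by
    rw [← Nat.card_Ico k n, ← Finset.prod_const, ← Finset.prod_mul_distrib]
    exact Finset.prod_congr rfl fun i _ => by ring
  rw [h1]
  have h2 : 0 < ∏ i ∈ Finset.range k, (x - z i) :=
    Finset.prod_pos fun i hi => sub_pos.2 (hlt i (Finset.mem_range.1 hi))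
  have h3 : 0 < ∏ i ∈ Finset.Ico k n, (z i - x) :=
    Finset.prod_pos fun i hi => sub_pos.2
      (hgt i (Finset.mem_Ico.1 hi).1 (Finset.mem_Ico.1 hi).2)
  have h4 : ((-1 : ℝ) ^ (n - k)) * (-1) ^ (n - k) = 1 := by
    rw [← mul_pow]; norm_num
  calc 0 < (∏ i ∈ Finset.range k, (x - z i)) * ∏ i ∈ Finset.Ico k n, (z i - x) := mul_pos h2 h3
    _ = _ := by
      linear_combination
        -((∏ i ∈ Finset.range k, (x - z i)) * ∏ i ∈ Finset.Ico k n, (z i - x)) * h4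

/-- A polynomial that changes sign between `a` and `b` has a zero between them. -/
theorem exists_eval_eq_zero_of_sign_change {p : ℝ[X]} {a b : ℝ} (hab : a < b) {m : ℕ}
    (ha : 0 < (-1) ^ (m + 1) * p.eval a) (hb : 0 < (-1) ^ m * p.eval b) :
    ∃ x ∈ Set.Ioo a b, p.eval x = 0 := by
  have hc : ContinuousOn (fun x => (-1) ^ m * p.eval x) (Set.Icc a b) := by fun_prop
  rw [pow_succ] at ha
  have h0 : (0 : ℝ) ∈ Set.Ioo ((-1) ^ m * p.eval a) ((-1) ^ m * p.eval b) := ⟨by linarith, hb⟩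
  obtain ⟨x, hx, hx0⟩ := intermediate_value_Ioo hab.le hc h0
  exact ⟨x, hx, (mul_eq_zero.1 hx0).resolve_left (by positivity)⟩

/-- The zeros of the Gegenbauer polynomial of degree `n + 1`, interlacing the one of degree `n`. -/
theorem gegenbauer_exists_zeros {α : ℝ} (hα : -1 / 2 < α) (n : ℕ) :
    ∃ z : ℕ → ℝ, (∀ i j, i < j → j ≤ n → z i < z j) ∧
      ∀ i ≤ n, z i ∈ Set.Ioo (-1 : ℝ) 1 ∧ (gegenbauer α (n + 1)).eval (z i) = 0 ∧
        0 < (-1) ^ (n - i) * (gegenbauer α n).eval (z i) := by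
  induction n with
  | zero => exact ⟨fun _ => 0, by omega, fun i hi => by simp [gegenbauer]⟩
  | succ n ih =>
    obtain ⟨z, hmono, hz⟩ := ih
    have hn : (0 : ℝ) ≤ n := n.cast_nonneg
    -- The old zeros flanked by -1 and 1: n + 3 points bounding n + 2 intervals, one for each new
    -- zero.
    let w : ℕ → ℝ := fun k => if k = 0 then -1 else if k ≤ n + 1 then z (k - 1) else 1
    have hw0 : w 0 = -1 := rfl
    have hw1 : ∀ k ≤ n, w (k + 1) = z k := fun k hk => by simp [w, hk]
    have hw2 : w (n + 2) = 1 := by simp [w]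
    have hwlt : ∀ k ≤ n + 1, w k < w (k + 1) := by
      intro k hk
      rcases Nat.eq_zero_or_pos k with rfl | h
      · rw [hw0, hw1 0 (by omega)]; exact (hz 0 (by omega)).1.1
      · obtain ⟨j, rfl⟩ := Nat.exists_eq_succ_of_ne_zero h.ne'
        rw [Nat.succ_eq_add_one, hw1 j (by omega)]
        rcases (show j ≤ n by omega).eq_or_lt with rfl | h
        · rw [hw2]; exact (hz j le_rfl).1.2
        · rw [hw1 (j + 1) h]; exact hmono j (j + 1) (by omega) h
    -- At a zero of G_{n+1} the recurrence makes G_{n+2} and G_n opposite in sign, so G_{n+2}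
    -- alternates along `w`; the end values are 1 and ±1.
    have hsign : ∀ k ≤ n + 2, 0 < (-1) ^ (n + 2 - k) * (gegenbauer α (n + 2)).eval (w k) := by
      intro k hk
      rcases Nat.eq_zero_or_pos k with rfl | h
      · rw [hw0, gegenbauer_eval_neg_one hα, Nat.sub_zero, ← mul_pow]; norm_num
      · obtain ⟨j, rfl⟩ := Nat.exists_eq_succ_of_ne_zero h.ne'
        rcases (show j ≤ n + 1 by omega).eq_or_lt with rfl | h
        · rw [hw2, gegenbauer_eval_one hα]; simp
        · obtain ⟨-, h0, hpos⟩ := hz j (by omega)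
          rw [Nat.succ_eq_add_one, hw1 j (by omega),
            show n + 2 - (j + 1) = (n - j) + 1 by omega, pow_succ]
          have hr := gegenbauer_eval_recurrence hα n (z j)
          rw [h0, mul_zero, zero_sub] at hr
          have hd : 0 < (n : ℝ) + 1 + 2 * α := by linarith
          refine pos_of_mul_pos_right ?_ hd.le
          calc 0 < ((n : ℝ) + 1) * ((-1) ^ (n - j) * (gegenbauer α n).eval (z j)) := by positivity
            _ = _ := by linear_combination (-1) ^ (n - j) * hr
    have hex : ∀ k, ∃ x, k ≤ n + 1 → x ∈ Set.Ioo (w k) (w (k + 1)) ∧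
        (gegenbauer α (n + 2)).eval x = 0 := by
      intro k
      by_cases hk : k ≤ n + 1
      · obtain ⟨x, hx, hx0⟩ := exists_eval_eq_zero_of_sign_change (p := gegenbauer α (n + 2))
          (m := n + 1 - k) (hwlt k hk)
          (by rw [show n + 1 - k + 1 = n + 2 - k by omega]; exact hsign k (by omega))
          (by rw [show n + 1 - k = n + 2 - (k + 1) by omega]; exact hsign (k + 1) (by omega))
        exact ⟨x, fun _ => ⟨hx, hx0⟩⟩
      · exact ⟨0, fun h => absurd h hk⟩
    choose y hy using hex
    have hwmono : ∀ i j, i ≤ j → j ≤ n + 2 → w i ≤ w j := by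
      intro i j hij
      induction j, hij using Nat.le_induction with
      | base => exact fun _ => le_rfl
      | succ j _ ih => exact fun h => (ih (by omega)).trans (hwlt j (by omega)).le
    -- The factorization yields the sign of G_{n+1} at each new zero `y i`, which has exactly i old
    -- zeros below it. This restores the induction hypothesis.
    have hprod : ∀ x, (gegenbauer α (n + 1)).eval x =
        gegenbauerLead α n * ∏ i ∈ Finset.range (n + 1), (x - z i) := by
      intro x
      have hinj : Function.Injective fun i : Fin (n + 1) => z i := by
        refine StrictMono.injective fun i j hij => hmono i j hij (by omega)
      have := eq_C_mul_nodal (gegenbauer_natDegree_le α (n + 1)) hinj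
        (fun i => (hz i (by omega)).2.1)
      rw [this, gegenbauer_coeff hα, eval_mul, eval_C, Lagrange.eval_nodal,
        Finset.prod_range fun i => x - z i]
    refine ⟨y, fun i j hij hj => ?_, fun i hi => ?_⟩
    · exact (hy i (by omega)).1.2.trans_le ((hwmono (i + 1) j hij (by omega)).trans
        (hy j hj).1.1.le)
    · obtain ⟨⟨hy1, hy2⟩, hy0⟩ := hy i hi
      refine ⟨⟨hw0 ▸ (hwmono 0 i (by omega) (by omega)).trans_lt hy1,
        hw2 ▸ hy2.trans_le (hwmono (i + 1) (n + 2) (by omega) le_rfl)⟩, hy0, ?_⟩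
      rw [hprod]
      have := neg_one_pow_mul_prod_pos (n := n + 1) (k := i) (z := z) (x := y i) hi
        (fun j hj => by
          rw [← hw1 j (by omega)]
          exact (hwmono (j + 1) i hj (by omega)).trans_lt hy1)
        (fun j hj hjn => by
          rw [← hw1 j (by omega)]
          exact hy2.trans_le (hwmono (i + 1) (j + 1) (by omega) (by omega)))
      have hl := gegenbauerLead_pos hα n
      calc 0 < gegenbauerLead α n * _ := mul_pos hl this
        _ = _ := by ring

theorem shiftedGegenbauer_eval (l α : ℝ) (n : ℕ) (x : ℝ) :
    (shiftedGegenbauer l α n).eval x = (gegenbauer α n).eval (2 / l * x - 1) := by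
  simp [shiftedGegenbauer]

theorem shiftedGegenbauer_natDegree_le (l α : ℝ) (n : ℕ) :
    (shiftedGegenbauer l α n).natDegree ≤ n := by
  refine natDegree_comp_le.trans ?_
  have : (C (2 / l) * X - 1 : ℝ[X]).natDegree ≤ 1 :=
    (natDegree_sub_le _ _).trans
      (max_le ((natDegree_C_mul_le _ _).trans natDegree_X_le) (by simp))
  calc _ ≤ n * 1 := Nat.mul_le_mul (gegenbauer_natDegree_le α n) this
    _ = n := mul_one n

theorem shiftedGegenbauer_coeff {l α : ℝ} (hα : -1 / 2 < α) (hl : 0 < l) (n : ℕ) :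
    (shiftedGegenbauer l α (n + 1)).coeff (n + 1) = gegenbauerLead α n * (2 / l) ^ (n + 1) := by
  have h2 : (2 / l : ℝ) ≠ 0 := by positivity
  have hd : (C (2 / l) * X - 1 : ℝ[X]).natDegree = 1 := by
    rw [show (C (2 / l) * X - 1 : ℝ[X]) = C (2 / l) * X + C (-1) by simp [sub_eq_add_neg]]
    exact natDegree_linear h2
  have hlc : (C (2 / l) * X - 1 : ℝ[X]).leadingCoeff = 2 / l := by
    rw [show (C (2 / l) * X - 1 : ℝ[X]) = C (2 / l) * X + C (-1) by simp [sub_eq_add_neg]]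
    exact leadingCoeff_linear h2
  have hg : (gegenbauer α (n + 1)).natDegree = n + 1 := by
    refine (gegenbauer_natDegree_le α (n + 1)).antisymm (le_natDegree_of_ne_zero ?_)
    rw [gegenbauer_coeff hα]
    exact (gegenbauerLead_pos hα n).ne'
  have h := leadingCoeff_comp (p := gegenbauer α (n + 1)) (q := C (2 / l) * X - 1) (by simp [hd])
  have hD := natDegree_comp (p := gegenbauer α (n + 1)) (q := C (2 / l) * X - 1)
  rw [hd, hg, mul_one] at hD
  rw [hlc, leadingCoeff, leadingCoeff, hD, hg, gegenbauer_coeff hα] at h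
  exact h

/-- The affine images of the n + 1 zeros in (-1, 1) exhaust the roots, by degree. The sorted list
thus has length n + 1, and the default value of `getD` in `sggNode` is never used. -/
theorem sggNodes {l α : ℝ} (hα : -1 / 2 < α) (hl : 0 < l) (n : ℕ) :
    Function.Injective (sggNode l α n) ∧ ∀ i, sggNode l α n i ∈ Set.Ioo 0 l ∧
      (shiftedGegenbauer l α (n + 1)).eval (sggNode l α n i) = 0 := by
  obtain ⟨z, hmono, hz⟩ := gegenbauer_exists_zeros hα n
  set p := shiftedGegenbauer l α (n + 1) with hp
  have hp0 : p ≠ 0 := by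
    intro h
    have := shiftedGegenbauer_coeff hα hl n
    rw [← hp, h, coeff_zero] at this
    have := gegenbauerLead_pos hα n
    have : 0 < gegenbauerLead α n * (2 / l) ^ (n + 1) := by positivity
    linarith
  let y : Fin (n + 1) → ℝ := fun i => l / 2 * (z i + 1)
  have hyinj : Function.Injective y := by
    refine StrictMono.injective fun i j hij => ?_
    have := hmono i j hij (by omega)
    exact mul_lt_mul_of_pos_left (by linarith) (by positivity)
  have hyroot : ∀ i, p.eval (y i) = 0 := by
    intro i
    rw [hp, shiftedGegenbauer_eval,
      show 2 / l * (l / 2 * (z i + 1)) - 1 = z i by field_simp; ring]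
    exact (hz i (by omega)).2.1
  have hroots : p.roots.toFinset = Finset.univ.image y := by
    symm
    refine Finset.eq_of_subset_of_card_le ?_ ?_
    · intro t ht
      obtain ⟨i, -, rfl⟩ := Finset.mem_image.1 ht
      rw [Multiset.mem_toFinset, mem_roots hp0]
      exact hyroot i
    · rw [Finset.card_image_of_injective _ hyinj, Finset.card_univ, Fintype.card_fin]
      exact (Multiset.toFinset_card_le _).trans
        ((card_roots' p).trans (shiftedGegenbauer_natDegree_le l α (n + 1)))
  have hlen : (sggNodeList l α n).length = n + 1 := by
    rw [sggNodeList, Finset.length_sort, ← hp, hroots,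
      Finset.card_image_of_injective _ hyinj, Finset.card_univ, Fintype.card_fin]
  have hget : ∀ i, sggNode l α n i = (sggNodeList l α n)[(i : ℕ)]'(by omega) := by
    intro i
    rw [sggNode, List.getD_eq_getElem]
  have hnodup : (sggNodeList l α n).Nodup := Finset.sort_nodup _ _
  refine ⟨fun i j hij => ?_, fun i => ?_⟩
  · rw [hget, hget] at hij
    exact Fin.ext ((hnodup.getElem_inj_iff).1 hij)
  · have hmem : sggNode l α n i ∈ sggNodeList l α n := by
      rw [hget]
      exact List.getElem_mem _
    rw [sggNodeList, Finset.mem_sort, ← hp, hroots] at hmem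
    obtain ⟨j, -, hj⟩ := Finset.mem_image.1 hmem
    rw [← hj]
    obtain ⟨⟨h1, h2⟩, -⟩ := hz j (by omega)
    refine ⟨⟨mul_pos (by positivity) (by linarith), ?_⟩, hyroot j⟩
    calc l / 2 * (z j + 1) < l / 2 * 2 := mul_lt_mul_of_pos_left (by linarith) (by positivity)
      _ = l := by ring

/-! ### The error of Lagrange interpolation. -/

/-- Iterated Rolle theorem: if `f` agrees with a polynomial at `m + 1` points, then the `m`-th
derivatives agree somewhere. -/
theorem exists_iteratedDerivWithin_eq_eval {a b : ℝ} (hab : a < b) (m : ℕ) :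
    ∀ (f : ℝ → ℝ) (p : ℝ[X]), ContDiffOn ℝ m f (Set.Icc a b) → ∀ t : ℕ → ℝ,
      (∀ i < m, t i < t (i + 1)) → (∀ i ≤ m, t i ∈ Set.Icc a b ∧ f (t i) = p.eval (t i)) →
      ∃ ξ ∈ Set.Icc a b, iteratedDerivWithin m f (Set.Icc a b) ξ = (derivative^[m] p).eval ξ := by
  induction m with
  | zero =>
    intro f p _ t _ h
    exact ⟨t 0, (h 0 le_rfl).1, by simpa using (h 0 le_rfl).2⟩
  | succ m ih =>
    intro f p hf t hlt h
    have hu : UniqueDiffOn ℝ (Set.Icc a b) := uniqueDiffOn_Icc hab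
    have hfd : DifferentiableOn ℝ f (Set.Icc a b) := hf.differentiableOn (by simp)
    -- Rolle for `f - p` between consecutive points of agreement. The points found are interior to
    -- [a, b], so `derivWithin` is the ordinary derivative there; for i > m the value is junk.
    have hrolle : ∀ i, ∃ x, i ≤ m → x ∈ Set.Ioo (t i) (t (i + 1)) ∧
        derivWithin f (Set.Icc a b) x = (derivative p).eval x := by
      intro i
      by_cases hi : i ≤ m
      · obtain ⟨h1, e1⟩ := h i (by omega)
        obtain ⟨h2, e2⟩ := h (i + 1) (by omega)
        have hsub : Set.Icc (t i) (t (i + 1)) ⊆ Set.Icc a b := Set.Icc_subset_Icc h1.1 h2.2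
        obtain ⟨x, hx, hx0⟩ := exists_deriv_eq_zero (f := fun x => f x - p.eval x)
          (hlt i (by omega)) ((hfd.continuousOn.mono hsub).sub (by fun_prop))
          (by simp [e1, e2])
        have hnhds : Set.Icc a b ∈ nhds x :=
          Icc_mem_nhds (h1.1.trans_lt hx.1) (hx.2.trans_le h2.2)
        have hd : DifferentiableAt ℝ f x := hfd.differentiableAt hnhds
        refine ⟨x, fun _ => ⟨hx, ?_⟩⟩
        rw [deriv_fun_sub hd p.differentiableAt, Polynomial.deriv] at hx0
        rw [derivWithin_of_mem_nhds hnhds]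
        linarith
      · exact ⟨0, fun h => absurd h hi⟩
    choose s hs using hrolle
    obtain ⟨ξ, hξ, e⟩ := ih (derivWithin f (Set.Icc a b)) (derivative p)
      (hf.derivWithin hu (by simp)) s
      (fun i hi => (hs i hi.le).1.2.trans (hs (i + 1) hi).1.1)
      (fun i hi => ⟨⟨(h i (by omega)).1.1.trans (hs i hi).1.1.le,
        (hs i hi).1.2.le.trans (h (i + 1) (by omega)).1.2⟩, (hs i hi).2⟩)
    exact ⟨ξ, hξ, by rw [iteratedDerivWithin_succ', e, Function.iterate_succ_apply]⟩

/-- Sorting the finite set makes it unnecessary to locate the evaluation point among the nodes. -/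
theorem exists_iteratedDerivWithin_eq_eval_of_finset {a b : ℝ} (hab : a < b) {m : ℕ}
    {f : ℝ → ℝ} {p : ℝ[X]} (hf : ContDiffOn ℝ m f (Set.Icc a b)) {s : Finset ℝ}
    (hs : s.card = m + 1) (h : ∀ x ∈ s, x ∈ Set.Icc a b ∧ f x = p.eval x) :
    ∃ ξ ∈ Set.Icc a b, iteratedDerivWithin m f (Set.Icc a b) ξ = (derivative^[m] p).eval ξ := by
  refine exists_iteratedDerivWithin_eq_eval hab m f p hf
    (fun i => if hi : i < m + 1 then s.orderEmbOfFin hs ⟨i, hi⟩ else 0) ?_ ?_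
  · intro i hi
    rw [dif_pos (by omega), dif_pos (by omega)]
    exact (s.orderEmbOfFin hs).strictMono (by simp)
  · intro i hi
    rw [dif_pos (by omega)]
    exact h _ (Finset.orderEmbOfFin_mem s hs _)

theorem eval_iterate_derivative_of_natDegree_le {p : ℝ[X]} {m : ℕ} (hp : p.natDegree ≤ m)
    (x : ℝ) : (derivative^[m] p).eval x = m.factorial * p.coeff m := by
  have hd : (derivative^[m] p).natDegree ≤ 0 := by
    have := natDegree_iterate_derivative p m
    omega
  rw [eq_C_of_natDegree_le_zero hd, eval_C, coeff_iterate_derivative]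
  simp [Nat.descFactorial_self]

/-- The pointwise error of Lagrange interpolation. -/
theorem abs_sub_interpolate_le {a b : ℝ} (hab : a < b) {m : ℕ} {f : ℝ → ℝ} {A : ℝ}
    (hf : ContDiffOn ℝ m f (Set.Icc a b))
    (hA : ∀ x ∈ Set.Icc a b, |iteratedDerivWithin m f (Set.Icc a b) x| ≤ A)
    {v : Fin m → ℝ} (hv : Function.Injective v) (hmem : ∀ i, v i ∈ Set.Icc a b) {x : ℝ}
    (hx : x ∈ Set.Icc a b) :
    |f x - (Lagrange.interpolate Finset.univ v fun i => f (v i)).eval x| ≤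
      A / m.factorial * |(Lagrange.nodal Finset.univ v).eval x| := by
  set P := Lagrange.interpolate Finset.univ v fun i => f (v i) with hP
  set W := Lagrange.nodal Finset.univ v with hW
  have hPv : ∀ i, P.eval (v i) = f (v i) := fun i =>
    Lagrange.eval_interpolate_at_node _ hv.injOn (Finset.mem_univ i)
  have hWv : ∀ i, W.eval (v i) = 0 := fun i =>
    Lagrange.eval_nodal_at_node (Finset.mem_univ i)
  by_cases hxv : ∃ i, v i = x
  · obtain ⟨i, rfl⟩ := hxv
    simp [hPv, hWv]
  · push Not at hxv
    have hWx : W.eval x ≠ 0 := by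
      rw [hW, Lagrange.eval_nodal]
      exact Finset.prod_ne_zero_iff.2 fun i _ => sub_ne_zero.2 (hxv i).symm
    -- With this `c`, the polynomial `P + C c * W` agrees with `f` at `x` as well as at the nodes,
    -- and its m-th derivative is the constant m! c.
    set c := (f x - P.eval x) / W.eval x with hc
    have hcW : c * W.eval x = f x - P.eval x := div_mul_cancel₀ _ hWx
    have hPd : P.degree < m := by
      have := Lagrange.degree_interpolate_lt (s := Finset.univ) (fun i => f (v i)) hv.injOn
      rwa [Finset.card_univ, Fintype.card_fin] at this
    have hWd : W.natDegree = m := by simp [hW, Lagrange.natDegree_nodal]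
    have hWm : W.coeff m = 1 := by
      have : W.Monic := Lagrange.nodal_monic
      rwa [Monic, leadingCoeff, hWd] at this
    have hnd : (P + C c * W).natDegree ≤ m :=
      natDegree_add_le_of_degree_le (natDegree_le_of_degree_le hPd.le)
        ((natDegree_C_mul_le _ _).trans hWd.le)
    have hcoef : (P + C c * W).coeff m = c := by
      rw [coeff_add, coeff_C_mul, hWm, coeff_eq_zero_of_degree_lt hPd]
      ring
    have hxs : x ∉ Finset.univ.image v := by
      intro h
      obtain ⟨i, -, hi⟩ := Finset.mem_image.1 h
      exact hxv i hi
    obtain ⟨ξ, hξ, e⟩ := exists_iteratedDerivWithin_eq_eval_of_finset hab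
      (p := P + C c * W) hf (s := insert x (Finset.univ.image v))
      (by rw [Finset.card_insert_of_notMem hxs, Finset.card_image_of_injective _ hv]; simp)
      (by
        intro y hy
        rcases Finset.mem_insert.1 hy with rfl | hy
        · exact ⟨hx, by rw [eval_add, eval_mul, eval_C, hcW]; ring⟩
        · obtain ⟨i, -, rfl⟩ := Finset.mem_image.1 hy
          exact ⟨hmem i, by simp [hPv, hWv]⟩)
    rw [eval_iterate_derivative_of_natDegree_le hnd, hcoef] at e
    have hb := hA ξ hξ
    have hm : (0 : ℝ) < m.factorial := by positivity
    rw [e, abs_mul, Nat.abs_cast] at hb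
    rw [← hcW, abs_mul]
    refine mul_le_mul_of_nonneg_right ?_ (abs_nonneg _)
    rw [le_div_iff₀ hm]
    linarith

/-! ### From interpolation error to quadrature error. -/

theorem bsgq_eq_integral (l α : ℝ) (n : ℕ) (f : ℝ → ℝ) (i : Fin (n + 1)) :
    bsgq l α n f i = ∫ x in (0 : ℝ)..sggNode l α n i,
      (Lagrange.interpolate Finset.univ (sggNode l α n) fun j => f (sggNode l α n j)).eval x := by
  simp only [Lagrange.interpolate_apply, eval_finsetSum, eval_mul, eval_C]
  rw [intervalIntegral.integral_finsetSum fun j _ =>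
    (Continuous.intervalIntegrable (by fun_prop) _ _)]
  simp only [bsgq, bsgim, intervalIntegral.integral_const_mul]
  exact Finset.sum_congr rfl fun j _ => mul_comm _ _

theorem abs_bsgqError_le_integral {l α : ℝ} (hα : -1 / 2 < α) (hl : 0 < l) {n : ℕ} {f : ℝ → ℝ}
    {A : ℝ} (hf : DerivBound l n f A) (i : Fin (n + 1)) :
    |bsgqError l α n f i| ≤ ∫ x in (0 : ℝ)..sggNode l α n i,
      A / (n + 1).factorial * |(Lagrange.nodal Finset.univ (sggNode l α n)).eval x| := by
  obtain ⟨hinj, hnode⟩ := sggNodes hα hl n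
  have hxi := (hnode i).1
  have hsub : Set.Icc 0 (sggNode l α n i) ⊆ Set.Icc 0 l := Set.Icc_subset_Icc_right hxi.2.le
  have hfi : IntervalIntegrable f MeasureTheory.volume 0 (sggNode l α n i) := by
    refine ContinuousOn.intervalIntegrable ?_
    rw [Set.uIcc_of_le hxi.1.le]
    exact hf.1.continuousOn.mono hsub
  rw [bsgqError, bsgq_eq_integral, ← Real.norm_eq_abs, ← intervalIntegral.integral_sub hfi
    (Continuous.intervalIntegrable (by fun_prop) _ _)]
  have hw : IntervalIntegrable (fun x => A / (n + 1).factorial *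
      |(Lagrange.nodal Finset.univ (sggNode l α n)).eval x|) MeasureTheory.volume 0
      (sggNode l α n i) := Continuous.intervalIntegrable (by fun_prop) _ _
  exact intervalIntegral.norm_integral_le_of_norm_le hxi.1.le
    (Filter.Eventually.of_forall fun x hx => abs_sub_interpolate_le hl hf.1 hf.2 hinj
      (fun j => Set.Ioo_subset_Icc_self (hnode j).1) (hsub (Set.Ioc_subset_Icc_self hx))) hw

/-- The nodal polynomial is monic with the zeros of the shifted polynomial, whose leading
coefficient is `gegenbauerLead α n * (2 / l) ^ (n + 1)`. -/
theorem eval_nodal_sggNode {l α : ℝ} (hα : -1 / 2 < α) (hl : 0 < l) (n : ℕ) (x : ℝ) :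
    (Lagrange.nodal Finset.univ (sggNode l α n)).eval x =
      (l / 2) ^ (n + 1) / gegenbauerLead α n * (gegenbauer α (n + 1)).eval (2 / l * x - 1) := by
  obtain ⟨hinj, hnode⟩ := sggNodes hα hl n
  have h := congrArg (eval x) (eq_C_mul_nodal (shiftedGegenbauer_natDegree_le l α (n + 1)) hinj
    fun i => (hnode i).2)
  rw [shiftedGegenbauer_coeff hα hl, eval_mul, eval_C, shiftedGegenbauer_eval] at h
  have := (gegenbauerLead_pos hα n).ne'
  rw [h, div_pow, div_pow]
  field_simp

/-- The factor in front of the maximum of the Gegenbauer polynomial in the error bounds. -/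
noncomputable def errorFactor (l α : ℝ) (n : ℕ) : ℝ :=
  (l / 2) ^ (n + 1) / gegenbauerLead α n / (n + 1).factorial

theorem errorFactor_pos {l α : ℝ} (hα : -1 / 2 < α) (hl : 0 < l) (n : ℕ) :
    0 < errorFactor l α n := by
  have := gegenbauerLead_pos hα n
  unfold errorFactor
  positivity

theorem abs_bsgqError_le_integral_gegenbauer {l α : ℝ} (hα : -1 / 2 < α) (hl : 0 < l) {n : ℕ}
    {f : ℝ → ℝ} {A : ℝ} (hf : DerivBound l n f A) (i : Fin (n + 1)) :
    |bsgqError l α n f i| ≤ A * errorFactor l α n * ∫ x in (0 : ℝ)..sggNode l α n i,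
      |(gegenbauer α (n + 1)).eval (2 / l * x - 1)| := by
  refine (abs_bsgqError_le_integral hα hl hf i).trans_eq ?_
  rw [← intervalIntegral.integral_const_mul]
  refine intervalIntegral.integral_congr fun x _ => ?_
  have := gegenbauerLead_pos hα n
  rw [eval_nodal_sggNode hα hl, abs_mul, abs_of_pos (by positivity), errorFactor]
  ring

theorem affine_mem_Icc {l x : ℝ} (hl : 0 < l) (hx : x ∈ Set.Icc 0 l) :
    2 / l * x - 1 ∈ Set.Icc (-1 : ℝ) 1 := by
  have h2 : 0 ≤ 2 / l * x := mul_nonneg (by positivity) hx.1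
  have h3 : 2 / l * x ≤ 2 := by
    rw [div_mul_eq_mul_div, div_le_iff₀ hl]
    linarith [hx.2]
  exact ⟨by linarith, by linarith⟩

theorem abs_bsgqError_le {l α : ℝ} (hα : -1 / 2 < α) (hl : 0 < l) {n : ℕ}
    {f : ℝ → ℝ} {A : ℝ} (hA : 0 < A) (hf : DerivBound l n f A) (i : Fin (n + 1)) {M : ℝ}
    (hM : ∀ x ∈ Set.Icc (-1 : ℝ) 1, |(gegenbauer α (n + 1)).eval x| ≤ M) :
    |bsgqError l α n f i| ≤ A * errorFactor l α n * (sggNode l α n i * M) := by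
  have hE := errorFactor_pos hα hl n
  obtain ⟨h0, h1⟩ := ((sggNodes hα hl n).2 i).1
  refine (abs_bsgqError_le_integral_gegenbauer hα hl hf i).trans
    (mul_le_mul_of_nonneg_left ?_ (by positivity))
  calc _ ≤ ∫ x in (0 : ℝ)..sggNode l α n i, M :=
        intervalIntegral.integral_mono_on h0.le (Continuous.intervalIntegrable (by fun_prop) _ _)
          (Continuous.intervalIntegrable (by fun_prop) _ _)
          fun x hx => hM _ (affine_mem_Icc hl ⟨hx.1, hx.2.trans h1.le⟩)
    _ = _ := by simp

/-- Strictness comes from the end point x_i: the continuous integrand vanishes there, while M > 0.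
-/
theorem abs_bsgqError_lt {l α : ℝ} (hα : -1 / 2 < α) (hl : 0 < l) {n : ℕ}
    {f : ℝ → ℝ} {A : ℝ} (hA : 0 < A) (hf : DerivBound l n f A) (i : Fin (n + 1)) {M : ℝ}
    (hM0 : 0 < M) (hM : ∀ x ∈ Set.Icc (-1 : ℝ) 1, |(gegenbauer α (n + 1)).eval x| ≤ M) :
    |bsgqError l α n f i| < A * errorFactor l α n * (sggNode l α n i * M) := by
  have hE := errorFactor_pos hα hl n
  obtain ⟨⟨h0, h1⟩, hz⟩ := (sggNodes hα hl n).2 i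
  refine (abs_bsgqError_le_integral_gegenbauer hα hl hf i).trans_lt
    (mul_lt_mul_of_pos_left ?_ (by positivity))
  calc _ < ∫ x in (0 : ℝ)..sggNode l α n i, M := by
        refine intervalIntegral.integral_lt_integral_of_continuousOn_of_le_of_exists_lt h0
          (by fun_prop) (by fun_prop)
          (fun x hx => hM _ (affine_mem_Icc hl ⟨hx.1.le, hx.2.trans h1.le⟩))
          ⟨sggNode l α n i, ⟨h0.le, le_rfl⟩, ?_⟩
        rw [← shiftedGegenbauer_eval, hz, abs_zero]
        exact hM0
    _ = _ := by simp

/-! ### The maximum of |G_{n+1}| on [-1, 1] by the Sonine function. -/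

theorem gegenbauer_eval_zero_odd {α : ℝ} (hα : -1 / 2 < α) (m : ℕ) :
    (gegenbauer α (2 * m + 1)).eval 0 = 0 := by
  induction m with
  | zero => simp [gegenbauer]
  | succ m ih =>
    have h := gegenbauer_eval_recurrence hα (2 * m + 1) 0
    rw [ih] at h
    have hm : (0 : ℝ) ≤ m := m.cast_nonneg
    refine (mul_eq_zero.1 (h.trans (by ring))).resolve_left ?_
    push_cast
    linarith

theorem gegenbauer_eval_zero_even {α : ℝ} (hα : -1 / 2 < α) (m : ℕ) :
    (2 * (m : ℝ) + 1 + 2 * α) * (gegenbauer α (2 * m + 2)).eval 0 =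
      -((2 * (m : ℝ) + 1) * (gegenbauer α (2 * m)).eval 0) := by
  have h := gegenbauer_eval_recurrence hα (2 * m) 0
  push_cast at h
  linear_combination h

theorem gegenbauer_derivative_eval_zero {α : ℝ} (hα : -1 / 2 < α) (n : ℕ) :
    (derivative (gegenbauer α (n + 1))).eval 0 = ((n : ℝ) + 1) * (gegenbauer α n).eval 0 := by
  have h := gegenbauer_eval_derivative hα n 0
  linarith

/-- The Sonine function of the Gegenbauer polynomial of degree `n + 1`. -/
noncomputable def sonine (α : ℝ) (n : ℕ) (x : ℝ) : ℝ :=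
  (gegenbauer α (n + 1)).eval x ^ 2 +
    (1 - x ^ 2) * (derivative (gegenbauer α (n + 1))).eval x ^ 2 / (((n : ℝ) + 1) * (2 * α + n + 1))

theorem sonine_denom_pos {α : ℝ} (hα : -1 / 2 < α) (n : ℕ) :
    0 < ((n : ℝ) + 1) * (2 * α + n + 1) := by
  have hn : (0 : ℝ) ≤ n := n.cast_nonneg
  exact mul_pos (by linarith) (by linarith)

/-- The denominator in `sonine` is the eigenvalue of the differential equation, so the G G' terms
cancel and the sign is that of α x. -/
theorem hasDerivAt_sonine {α : ℝ} (hα : -1 / 2 < α) (n : ℕ) (x : ℝ) :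
    HasDerivAt (sonine α n)
      (4 * α / (((n : ℝ) + 1) * (2 * α + n + 1)) *
        (derivative (gegenbauer α (n + 1))).eval x ^ 2 * x) x := by
  have hN := (sonine_denom_pos hα n).ne'
  have h1 := (gegenbauer α (n + 1)).hasDerivAt x
  have h2 := (derivative (gegenbauer α (n + 1))).hasDerivAt x
  have h3 : HasDerivAt (fun x : ℝ => 1 - x ^ 2) (-(2 * x)) x := by
    simpa using (hasDerivAt_pow 2 x).const_sub 1
  have h := (h1.fun_pow 2).add ((h3.fun_mul (h2.fun_pow 2)).div_const
    (((n : ℝ) + 1) * (2 * α + n + 1)))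
  refine h.congr_deriv ?_
  have ho := gegenbauer_ode hα n x
  rw [div_mul_eq_mul_div, div_mul_eq_mul_div, eq_div_iff hN, add_mul, div_mul_cancel₀ _ hN]
  simp
  linear_combination 2 * (derivative (gegenbauer α (n + 1))).eval x * ho

theorem sq_eval_le_sonine {α : ℝ} (hα : -1 / 2 < α) (n : ℕ) {x : ℝ} (hx : x ∈ Set.Icc (-1 : ℝ) 1) :
    (gegenbauer α (n + 1)).eval x ^ 2 ≤ sonine α n x := by
  have hN := sonine_denom_pos hα n
  have : 0 ≤ 1 - x ^ 2 := by nlinarith [hx.1, hx.2]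
  have : 0 ≤ (1 - x ^ 2) * (derivative (gegenbauer α (n + 1))).eval x ^ 2
      / (((n : ℝ) + 1) * (2 * α + n + 1)) := by positivity
  unfold sonine
  linarith

theorem continuous_sonine {α : ℝ} (hα : -1 / 2 < α) (n : ℕ) : Continuous (sonine α n) :=
  continuous_iff_continuousAt.2 fun x => (hasDerivAt_sonine hα n x).continuousAt

/-- Here S decreases on [-1, 0] and increases on [0, 1]; at ±1 its second term vanishes and G² = 1.
-/
theorem sonine_le_one {α : ℝ} (hα : 0 ≤ α) (n : ℕ) {x : ℝ} (hx : x ∈ Set.Icc (-1 : ℝ) 1) :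
    sonine α n x ≤ 1 := by
  have hα' : -1 / 2 < α := by linarith
  have hN := sonine_denom_pos hα' n
  have hc : 0 ≤ 4 * α / (((n : ℝ) + 1) * (2 * α + n + 1)) := by positivity
  rcases le_total 0 x with h | h
  · have hm : MonotoneOn (sonine α n) (Set.Icc 0 1) := by
      refine monotoneOn_of_hasDerivWithinAt_nonneg (convex_Icc 0 1)
        (continuous_sonine hα' n).continuousOn
        (fun x _ => (hasDerivAt_sonine hα' n x).hasDerivWithinAt) fun x hx => ?_
      rw [interior_Icc] at hx
      have := hx.1
      positivity
    refine (hm ⟨h, hx.2⟩ ⟨zero_le_one, le_rfl⟩ hx.2).trans_eq ?_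
    simp [sonine, gegenbauer_eval_one hα']
  · have hm : AntitoneOn (sonine α n) (Set.Icc (-1) 0) := by
      refine antitoneOn_of_hasDerivWithinAt_nonpos (convex_Icc (-1) 0)
        (continuous_sonine hα' n).continuousOn
        (fun x _ => (hasDerivAt_sonine hα' n x).hasDerivWithinAt) fun x hx => ?_
      rw [interior_Icc] at hx
      exact mul_nonpos_of_nonneg_of_nonpos (by positivity) hx.2.le
    refine (hm ⟨le_rfl, by norm_num⟩ ⟨hx.1, h⟩ hx.1).trans_eq ?_
    simp [sonine, gegenbauer_eval_neg_one hα', ← pow_mul]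

theorem sonine_le_sonine_zero {α : ℝ} (hα : -1 / 2 < α) (hα0 : α < 0) (n : ℕ) {x : ℝ}
    (hx : x ∈ Set.Icc (-1 : ℝ) 1) : sonine α n x ≤ sonine α n 0 := by
  have hN := sonine_denom_pos hα n
  have hc : 4 * α / (((n : ℝ) + 1) * (2 * α + n + 1)) ≤ 0 :=
    div_nonpos_of_nonpos_of_nonneg (by linarith) hN.le
  rcases le_total 0 x with h | h
  · have hm : AntitoneOn (sonine α n) (Set.Icc 0 1) := by
      refine antitoneOn_of_hasDerivWithinAt_nonpos (convex_Icc 0 1)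
        (continuous_sonine hα n).continuousOn
        (fun x _ => (hasDerivAt_sonine hα n x).hasDerivWithinAt) fun x hx => ?_
      rw [interior_Icc] at hx
      exact mul_nonpos_of_nonpos_of_nonneg
        (mul_nonpos_of_nonpos_of_nonneg hc (by positivity)) hx.1.le
    exact hm ⟨le_rfl, zero_le_one⟩ ⟨h, hx.2⟩ h
  · have hm : MonotoneOn (sonine α n) (Set.Icc (-1) 0) := by
      refine monotoneOn_of_hasDerivWithinAt_nonneg (convex_Icc (-1) 0)
        (continuous_sonine hα n).continuousOn
        (fun x _ => (hasDerivAt_sonine hα n x).hasDerivWithinAt) fun x hx => ?_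
      rw [interior_Icc] at hx
      exact mul_nonneg_of_nonpos_of_nonpos
        (mul_nonpos_of_nonpos_of_nonneg hc (by positivity)) hx.2.le
    exact hm ⟨hx.1, h⟩ ⟨by norm_num, le_rfl⟩ h

theorem abs_gegenbauer_le_one {α : ℝ} (hα : 0 ≤ α) (n : ℕ) {x : ℝ}
    (hx : x ∈ Set.Icc (-1 : ℝ) 1) : |(gegenbauer α (n + 1)).eval x| ≤ 1 :=
  (sq_le_one_iff_abs_le_one _).1
    ((sq_eval_le_sonine (by linarith) n hx).trans (sonine_le_one hα n hx))

/-- The degree n + 1 is even, so G' vanishes at 0 and S(0) = G(0)². -/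
theorem abs_gegenbauer_le_of_odd {α : ℝ} (hα : -1 / 2 < α) (hα0 : α < 0) {n : ℕ} (hn : Odd n)
    {x : ℝ} (hx : x ∈ Set.Icc (-1 : ℝ) 1) :
    |(gegenbauer α (n + 1)).eval x| ≤ |(gegenbauer α (n + 1)).eval 0| := by
  refine sq_le_sq.1 ((sq_eval_le_sonine hα n hx).trans
    ((sonine_le_sonine_zero hα hα0 n hx).trans_eq ?_))
  obtain ⟨m, rfl⟩ := hn
  simp [sonine, gegenbauer_derivative_eval_zero hα, gegenbauer_eval_zero_odd hα]

/-- The degree n + 1 is odd, so G vanishes at 0 and only the derivative term of S(0) remains, with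
G_{n+1}'(0) = (n+1) G_n(0). -/
theorem abs_gegenbauer_le_of_even {α : ℝ} (hα : -1 / 2 < α) (hα0 : α < 0) {n : ℕ} (hn : Even n)
    {x : ℝ} (hx : x ∈ Set.Icc (-1 : ℝ) 1) :
    |(gegenbauer α (n + 1)).eval x| ≤
      ((n : ℝ) + 1) * |(gegenbauer α n).eval 0| / √(((n : ℝ) + 1) * (2 * α + n + 1)) := by
  have hN := sonine_denom_pos hα n
  refine abs_le_of_sq_le_sq ((sq_eval_le_sonine hα n hx).trans
    ((sonine_le_sonine_zero hα hα0 n hx).trans_eq ?_)) (by positivity)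
  obtain ⟨m, rfl⟩ := hn
  rw [sonine, gegenbauer_derivative_eval_zero hα, ← two_mul, gegenbauer_eval_zero_odd hα, div_pow,
    Real.sq_sqrt (by rw [two_mul]; exact hN.le), mul_pow, mul_pow, sq_abs]
  ring

/-! ### Closed forms with Gamma functions and generalized binomial coefficients. -/

theorem succ_mul_ring_choose (β : ℝ) (m : ℕ) :
    ((m : ℝ) + 1) * Ring.choose (((m + 1 : ℕ) : ℝ) + β) (m + 1) =
      (m + β + 1) * Ring.choose (m + β) m := by
  have h := Ring.choose_add_smul_choose ((m : ℝ) + β) m 1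
  rw [Nat.choose_one_right, nsmul_eq_mul, Ring.choose_one_right] at h
  push_cast at h ⊢
  rw [show (m : ℝ) + 1 + β = m + β + 1 by ring]
  exact h

theorem succ_mul_ring_choose_succ (β : ℝ) (m : ℕ) :
    ((m : ℝ) + 1) * Ring.choose (m + β) (m + 1) = β * Ring.choose (m + β) m := by
  have h := Ring.choose_smul_choose ((m : ℝ) + β) (Nat.le_succ m)
  rw [Nat.choose_succ_self_right, nsmul_eq_mul, Nat.succ_eq_add_one, Nat.add_sub_cancel_left,
    Ring.choose_one_right] at h
  push_cast at h
  linear_combination h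

theorem factorial_mul_Gamma_mul_ring_choose {β : ℝ} (hβ : ∀ m : ℕ, (m : ℝ) + β + 1 ≠ 0) (m : ℕ) :
    m.factorial * Real.Gamma (β + 1) * Ring.choose (m + β) m = Real.Gamma (m + β + 1) := by
  induction m with
  | zero => simp
  | succ m ih =>
    have h := succ_mul_ring_choose β m
    have hG := Real.Gamma_add_one (hβ m)
    rw [show (((m + 1 : ℕ) : ℝ) + β + 1) = m + β + 1 + 1 by push_cast; ring, hG, ← ih,
      Nat.factorial_succ]
    push_cast at h ⊢
    linear_combination m.factorial * Real.Gamma (β + 1) * h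

theorem Gamma_mul_abs_gegenbauer_eval_zero {α : ℝ} (hα : -1 / 2 < α) (m : ℕ) :
    Real.Gamma (2 * m + 2 * α + 1) * |(gegenbauer α (2 * m)).eval 0| =
      (2 * m).factorial * Real.Gamma (2 * α + 1) * |Ring.choose (m + α) m| := by
  induction m with
  | zero => simp [gegenbauer]
  | succ m ih =>
    have hm : (0 : ℝ) ≤ m := m.cast_nonneg
    have h := congrArg abs (gegenbauer_eval_zero_even hα m)
    rw [abs_neg, abs_mul, abs_mul, abs_of_pos (show 0 < 2 * (m : ℝ) + 1 + 2 * α by linarith),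
      abs_of_pos (show 0 < 2 * (m : ℝ) + 1 by linarith)] at h
    have hc := congrArg abs (succ_mul_ring_choose α m)
    rw [abs_mul, abs_mul, abs_of_pos (show 0 < (m : ℝ) + 1 by linarith),
      abs_of_pos (show 0 < (m : ℝ) + α + 1 by linarith)] at hc
    have hG1 := Real.Gamma_add_one (s := 2 * m + 2 * α + 1) (by linarith)
    have hG2 := Real.Gamma_add_one (s := 2 * m + 2 * α + 1 + 1) (by linarith)
    rw [show 2 * ((m + 1 : ℕ) : ℝ) + 2 * α + 1 = 2 * m + 2 * α + 1 + 1 + 1 by push_cast; ring,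
      hG2, hG1, show 2 * (m + 1) = 2 * m + 1 + 1 by ring, Nat.factorial_succ, Nat.factorial_succ]
    push_cast at hc ⊢
    linear_combination (2 * (m : ℝ) + 2 * α + 1 + 1) * Real.Gamma (2 * m + 2 * α + 1) * h +
      (2 * (m : ℝ) + 2 * α + 1 + 1) * (2 * m + 1) * ih -
      2 * (2 * (m : ℝ) + 1) * (2 * m).factorial * Real.Gamma (2 * α + 1) * hc

/-- Raising the lower index of the binomial to m + 1 brings in a factor α, absorbed by Γ(2α+1) = 2α
Γ(2α); this needs α ≠ 0. -/
theorem Gamma_mul_abs_gegenbauer_eval_zero_succ {α : ℝ} (hα : -1 / 2 < α) (hα0 : α < 0) (m : ℕ) :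
    Real.Gamma (2 * m + 2 + 2 * α) * |(gegenbauer α (2 * m + 2)).eval 0| =
      (2 * m + 2).factorial * |Real.Gamma (2 * α)| * |Ring.choose (m + α) (m + 1)| := by
  have hm : (0 : ℝ) ≤ m := m.cast_nonneg
  have h := congrArg abs (gegenbauer_eval_zero_even hα m)
  rw [abs_neg, abs_mul, abs_mul, abs_of_pos (show 0 < 2 * (m : ℝ) + 1 + 2 * α by linarith),
    abs_of_pos (show 0 < 2 * (m : ℝ) + 1 by linarith)] at h
  have hc := congrArg abs (succ_mul_ring_choose_succ α m)
  rw [abs_mul, abs_mul, abs_of_pos (by linarith)] at hc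
  have hG1 := Real.Gamma_add_one (s := 2 * m + 2 * α + 1) (by linarith)
  have hG2 := congrArg abs (Real.Gamma_add_one (s := 2 * α) (by linarith))
  rw [abs_of_pos (Real.Gamma_pos_of_pos (by linarith)), abs_mul, abs_mul, abs_two] at hG2
  have h0 := Gamma_mul_abs_gegenbauer_eval_zero hα m
  rw [show 2 * (m : ℝ) + 2 + 2 * α = 2 * m + 2 * α + 1 + 1 by ring, hG1, Nat.factorial_succ,
    Nat.factorial_succ]
  push_cast
  rw [hG2] at h0
  linear_combination Real.Gamma (2 * m + 2 * α + 1) * h + (2 * m + 1) * h0 -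
    2 * (2 * m + 1) * (2 * m).factorial * |Real.Gamma (2 * α)| * hc

theorem two_zpow_eq (n : ℕ) : (2 : ℝ) ^ (-2 * (n : ℤ) - 1) = 1 / 2 ^ (2 * n + 1) := by
  rw [show -2 * (n : ℤ) - 1 = -((2 * n + 1 : ℕ) : ℤ) by push_cast; ring, zpow_neg, zpow_natCast,
    one_div]

theorem Gamma_natCast_add_two (n : ℕ) : Real.Gamma (n + 2) = (n + 1) * n.factorial := by
  have h := Real.Gamma_nat_eq_factorial (n + 1)
  rw [Nat.factorial_succ] at h
  push_cast at h
  rw [← h]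
  ring_nf

/-- The part of the error bound that does not depend on `l`. -/
noncomputable def gammaFactor (α : ℝ) (n : ℕ) : ℝ :=
  Real.Gamma (α + 1) * Real.Gamma (n + 2 * α + 1) /
    (Real.Gamma (2 * α + 1) * Real.Gamma (n + 2) * Real.Gamma (n + α + 1))

theorem errorFactor_eq {α : ℝ} (hα : -1 / 2 < α) (l : ℝ) (n : ℕ) :
    errorFactor l α n = l ^ (n + 1) / 2 ^ (2 * n + 1) * gammaFactor α n := by
  have hn : (0 : ℝ) ≤ n := n.cast_nonneg
  have h1 := (Real.Gamma_pos_of_pos (s := n + α + 1) (by linarith)).ne'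
  have h2 := (Real.Gamma_pos_of_pos (s := 2 * α + 1) (by linarith)).ne'
  have h3 := (Real.Gamma_pos_of_pos (s := n + 2 * α + 1) (by linarith)).ne'
  have h4 := (Real.Gamma_pos_of_pos (s := α + 1) (by linarith)).ne'
  have h5 : (n : ℝ) + 1 ≠ 0 := by positivity
  have h6 : (n.factorial : ℝ) ≠ 0 := by positivity
  rw [errorFactor, gammaFactor, gegenbauerLead, Gamma_natCast_add_two, Nat.factorial_succ, div_pow]
  push_cast
  field_simp
  ring

theorem gammaFactor_pos {α : ℝ} (hα : -1 / 2 < α) (n : ℕ) : 0 < gammaFactor α n := by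
  have hn : (0 : ℝ) ≤ n := n.cast_nonneg
  have h1 := Real.Gamma_pos_of_pos (s := n + α + 1) (by linarith)
  have h2 := Real.Gamma_pos_of_pos (s := 2 * α + 1) (by linarith)
  have h3 := Real.Gamma_pos_of_pos (s := n + 2 * α + 1) (by linarith)
  have h4 := Real.Gamma_pos_of_pos (s := α + 1) (by linarith)
  have h5 := Real.Gamma_pos_of_pos (s := (n : ℝ) + 2) (by linarith)
  unfold gammaFactor
  positivity

/-- A bound for the Gegenbauer polynomial of degree `n + 1` on `[-1, 1]`. -/
noncomputable def gegenbauerBound (α : ℝ) (n : ℕ) : ℝ :=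
  if 0 ≤ α then 1 else
    if Even n then ((n : ℝ) + 1) * |(gegenbauer α n).eval 0| / √(((n : ℝ) + 1) * (2 * α + n + 1))
    else |(gegenbauer α (n + 1)).eval 0|

theorem abs_gegenbauer_le {α : ℝ} (hα : -1 / 2 < α) (n : ℕ) {x : ℝ}
    (hx : x ∈ Set.Icc (-1 : ℝ) 1) : |(gegenbauer α (n + 1)).eval x| ≤ gegenbauerBound α n := by
  unfold gegenbauerBound
  split_ifs with h0 he
  · exact abs_gegenbauer_le_one h0 n hx
  · exact abs_gegenbauer_le_of_even hα (not_le.1 h0) he hx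
  · exact abs_gegenbauer_le_of_odd hα (not_le.1 h0) (Nat.not_even_iff_odd.1 he) hx

/-- Evaluation at x = 1; this supplies the positivity of the bound. -/
theorem one_le_gegenbauerBound {α : ℝ} (hα : -1 / 2 < α) (n : ℕ) : 1 ≤ gegenbauerBound α n := by
  have h := abs_gegenbauer_le hα n (x := 1) (by simp)
  rwa [gegenbauer_eval_one hα, abs_one] at h

theorem gegenbauerBound_of_odd {α : ℝ} (hα : -1 / 2 < α) (hα0 : α < 0) {n : ℕ}
    (hn : Odd n) :
    gegenbauerBound α n = ((n + 1).factorial : ℝ) * |Real.Gamma (2 * α)| /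
      Real.Gamma (n + 2 * α + 1) * |Ring.choose (((n : ℝ) + 1) / 2 + α - 1) ((n + 1) / 2)| := by
  have hn0 : (0 : ℝ) ≤ n := n.cast_nonneg
  have h3 := (Real.Gamma_pos_of_pos (s := n + 2 * α + 1) (by linarith)).ne'
  rw [gegenbauerBound, if_neg (not_le.2 hα0), if_neg (Nat.not_even_iff_odd.2 hn)]
  obtain ⟨m, rfl⟩ := hn
  have h := Gamma_mul_abs_gegenbauer_eval_zero_succ hα hα0 m
  rw [show (((2 * m + 1 : ℕ) : ℝ) + 1) / 2 + α - 1 = m + α by push_cast; ring,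
    show (2 * m + 1 + 1) / 2 = m + 1 by omega, div_mul_eq_mul_div, eq_div_iff h3, ← h, mul_comm]
  congr 2
  push_cast
  ring

theorem gammaFactor_mul_gegenbauerBound_of_even {α : ℝ} (hα : -1 / 2 < α) (hα0 : α < 0) {n : ℕ}
    (hn : Even n) :
    gammaFactor α n * gegenbauerBound α n = Real.Gamma (α + 1) /
      (√(((n : ℝ) + 1) * (2 * α + n + 1)) * Real.Gamma (n + α + 1)) *
        |Ring.choose ((n : ℝ) / 2 + α) (n / 2)| := by
  have hn0 : (0 : ℝ) ≤ n := n.cast_nonneg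
  have h1 := (Real.Gamma_pos_of_pos (s := n + α + 1) (by linarith)).ne'
  have h2 := (Real.Gamma_pos_of_pos (s := 2 * α + 1) (by linarith)).ne'
  have hN := (Real.sqrt_pos.2 (sonine_denom_pos hα n)).ne'
  have h5 : (n : ℝ) + 1 ≠ 0 := by positivity
  have h6 : (n.factorial : ℝ) ≠ 0 := by positivity
  have h : Real.Gamma (n + 2 * α + 1) * |(gegenbauer α n).eval 0| =
      n.factorial * Real.Gamma (2 * α + 1) * |Ring.choose ((n : ℝ) / 2 + α) (n / 2)| := by
    obtain ⟨m, rfl⟩ := hn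
    have h := Gamma_mul_abs_gegenbauer_eval_zero hα m
    rw [← two_mul, show ((2 * m : ℕ) : ℝ) / 2 = m by push_cast; ring,
      show 2 * m / 2 = m by omega, ← h]
    push_cast
    rfl
  rw [gegenbauerBound, if_neg (not_le.2 hα0), if_pos hn, gammaFactor, Gamma_natCast_add_two,
    eq_div_of_mul_eq (mul_ne_zero h6 h2) ((mul_comm _ _).trans h.symm)]
  field_simp

/-! ### Asymptotic size of the bounds. -/

theorem prod_mul_Gamma {s : ℝ} (hs : ∀ j : ℕ, s + j ≠ 0) (n : ℕ) :
    (∏ j ∈ Finset.range n, (s + j)) * Real.Gamma s = Real.Gamma (s + n) := by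
  induction n with
  | zero => simp
  | succ n ih =>
    rw [Finset.prod_range_succ, mul_right_comm, ih, Nat.cast_succ, ← add_assoc,
      Real.Gamma_add_one (hs n), mul_comm]

/-- Euler's limit: `Real.GammaSeq s n` divided by Γ(s) equals n^s n! / Γ(n+s+1) and tends to 1, so
it eventually lies in (1/2, 2). The case s = 0 is separate because Γ has a pole there. -/
theorem Gamma_natCast_add_bounds {s : ℝ} (hs : -1 < s) :
    ∃ N : ℕ, ∀ n : ℕ, N ≤ n → (n : ℝ) ^ s * n.factorial ≤ 2 * Real.Gamma (n + s + 1) ∧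
      Real.Gamma (n + s + 1) ≤ 2 * ((n : ℝ) ^ s * n.factorial) := by
  rcases eq_or_ne s 0 with rfl | h0
  · refine ⟨0, fun n _ => ?_⟩
    have : (0 : ℝ) < n.factorial := by positivity
    simp only [add_zero, Real.Gamma_nat_eq_factorial, Real.rpow_zero]
    constructor <;> linarith
  · have hs' : ∀ j : ℕ, s + j ≠ 0 := by
      rintro (_ | j)
      · simpa using h0
      · have : (0 : ℝ) ≤ j := j.cast_nonneg
        push_cast
        linarith
    have hG : Real.Gamma s ≠ 0 := Real.Gamma_ne_zero fun m h => hs' m (by rw [h]; ring)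
    have hlim := (Real.GammaSeq_tendsto_Gamma s).div_const (Real.Gamma s)
    rw [div_self hG] at hlim
    have h1 := hlim.eventually (Ioo_mem_nhds (show (1 / 2 : ℝ) < 1 by norm_num) one_lt_two)
    obtain ⟨N, hN⟩ := Filter.eventually_atTop.1 h1
    refine ⟨N, fun n hn => ?_⟩
    obtain ⟨h2, h3⟩ := hN n hn
    have hn0 : (0 : ℝ) ≤ n := n.cast_nonneg
    have hpos := Real.Gamma_pos_of_pos (s := n + s + 1) (by linarith)
    have hp := prod_mul_Gamma hs' (n + 1)
    rw [Real.GammaSeq, div_div, hp,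
      show s + ((n + 1 : ℕ) : ℝ) = n + s + 1 by push_cast; ring] at h2 h3
    rw [lt_div_iff₀ hpos] at h2
    rw [div_lt_iff₀ hpos] at h3
    constructor <;> linarith

theorem rpow_le_exp_mul_factorial {n : ℕ} (hn : 1 ≤ n) :
    (n : ℝ) ^ ((n : ℝ) + 1 / 2) ≤ Real.exp n * n.factorial := by
  have hn' : (1 : ℝ) ≤ n := by exact_mod_cast hn
  have h := Stirling.le_factorial_stirling n
  have h1 : √(n : ℝ) ≤ √(2 * Real.pi * n) := Real.sqrt_le_sqrt (by
    nlinarith [Real.pi_gt_three])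
  have he : Real.exp n = Real.exp 1 ^ n := by rw [← Real.exp_nat_mul, mul_one]
  have h2 : √(n : ℝ) * (n / Real.exp 1) ^ n ≤ n.factorial :=
    (mul_le_mul_of_nonneg_right h1 (by positivity)).trans h
  rw [div_pow, ← he, ← mul_div_assoc, div_le_iff₀ (Real.exp_pos _)] at h2
  rw [Real.rpow_add (by linarith), Real.rpow_natCast, ← Real.sqrt_eq_rpow]
  linarith

/-- After the Gamma factors cancel, the same binomial as for even n remains, so both parities can be
estimated together. -/
theorem gammaFactor_mul_gegenbauerBound_of_odd {α : ℝ} (hα : -1 / 2 < α) (hα0 : α < 0) (m : ℕ) :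
    gammaFactor α (2 * m + 1) * gegenbauerBound α (2 * m + 1) =
      Real.Gamma (α + 1) / ((2 * (m : ℝ) + 2) * Real.Gamma (((2 * m + 1 : ℕ) : ℝ) + α + 1)) *
        |Ring.choose (m + α) m| := by
  have hm : (0 : ℝ) ≤ m := m.cast_nonneg
  have h1 := (Real.Gamma_pos_of_pos (s := ((2 * m + 1 : ℕ) : ℝ) + α + 1)
    (by push_cast; linarith)).ne'
  have h2 := (Real.Gamma_pos_of_pos (s := 2 * α + 1) (by linarith)).ne'
  have h3 := (Real.Gamma_pos_of_pos (s := ((2 * m + 1 : ℕ) : ℝ) + 2 * α + 1)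
    (by push_cast; linarith)).ne'
  have h6 : ((2 * m + 1).factorial : ℝ) ≠ 0 := by positivity
  have h7 : (m : ℝ) + 1 ≠ 0 := by positivity
  have hc := congrArg abs (succ_mul_ring_choose_succ α m)
  rw [abs_mul, abs_mul, abs_of_pos (show 0 < (m : ℝ) + 1 by linarith)] at hc
  have hG := congrArg abs (Real.Gamma_add_one (s := 2 * α) (by linarith))
  rw [abs_of_pos (Real.Gamma_pos_of_pos (by linarith)), abs_mul, abs_mul, abs_two] at hG
  have h8 : |α| ≠ 0 := abs_ne_zero.2 hα0.ne
  have h9 : |Real.Gamma (2 * α)| ≠ 0 := by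
    intro h
    rw [h, mul_zero] at hG
    exact h2 hG
  have hf : ((2 * m + 1 + 1).factorial : ℝ) = 2 * ((m : ℝ) + 1) * (2 * m + 1).factorial := by
    rw [Nat.factorial_succ]
    push_cast
    ring
  rw [gegenbauerBound_of_odd hα hα0 ⟨m, rfl⟩, gammaFactor, Gamma_natCast_add_two,
    show (((2 * m + 1 : ℕ) : ℝ) + 1) / 2 + α - 1 = m + α by push_cast; ring,
    show (2 * m + 1 + 1) / 2 = m + 1 by omega, hf,
    eq_div_of_mul_eq h7 ((mul_comm _ _).trans hc), hG,
    show ((2 * m + 1 : ℕ) : ℝ) + 1 = 2 * (m + 1) by push_cast; ring,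
    show 2 * (m : ℝ) + 2 = 2 * (m + 1) by ring]
  generalize |Real.Gamma (2 * α)| = a at h9 ⊢
  generalize Real.Gamma (((2 * m + 1 : ℕ) : ℝ) + 2 * α + 1) = b at h3 ⊢
  field_simp

theorem gammaFactor_mul_gegenbauerBound_le_choose {α : ℝ} (hα : -1 / 2 < α) (hα0 : α < 0) {n : ℕ}
    (hn : 1 ≤ n) :
    gammaFactor α n * gegenbauerBound α n ≤ Real.Gamma (α + 1) / (n * Real.Gamma (n + α + 1)) *
      |Ring.choose (((n / 2 : ℕ) : ℝ) + α) (n / 2)| := by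
  have hn' : (0 : ℝ) < n := by exact_mod_cast hn
  have h1 := Real.Gamma_pos_of_pos (s := n + α + 1) (by linarith)
  have h4 := Real.Gamma_pos_of_pos (s := α + 1) (by linarith)
  rcases Nat.even_or_odd n with he | ho
  · have hN : (n : ℝ) ≤ √(((n : ℝ) + 1) * (2 * α + n + 1)) :=
      -- Since 2α > -1, (n+1)(2α+n+1) ≥ (n+1) n ≥ n².
      Real.le_sqrt_of_sq_le (by nlinarith)
    rw [gammaFactor_mul_gegenbauerBound_of_even hα hα0 he,
      Nat.cast_div (even_iff_two_dvd.1 he) two_ne_zero, Nat.cast_two]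
    gcongr
  · obtain ⟨m, rfl⟩ := ho
    rw [gammaFactor_mul_gegenbauerBound_of_odd hα hα0, show (2 * m + 1) / 2 = m by omega]
    gcongr
    push_cast
    linarith

theorem abs_ring_choose_le {α : ℝ} (hα : -1 < α) :
    ∃ N : ℕ, ∀ m : ℕ, N ≤ m → |Ring.choose (m + α) m| ≤ 2 / Real.Gamma (α + 1) * (m : ℝ) ^ α := by
  obtain ⟨N, hN⟩ := Gamma_natCast_add_bounds hα
  refine ⟨N, fun m hm => ?_⟩
  have h4 := Real.Gamma_pos_of_pos (s := α + 1) (by linarith)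
  have hm0 : (0 : ℝ) ≤ m := m.cast_nonneg
  have hf : (0 : ℝ) < m.factorial := by positivity
  have h := congrArg abs (factorial_mul_Gamma_mul_ring_choose (β := α) (fun k => by
    have : (0 : ℝ) ≤ k := k.cast_nonneg
    linarith) m)
  rw [abs_mul, abs_of_pos (by positivity),
    abs_of_pos (Real.Gamma_pos_of_pos (s := m + α + 1) (by linarith))] at h
  have h2 := (hN m hm).2
  rw [← h] at h2
  rw [div_mul_eq_mul_div, le_div_iff₀ h4]
  refine le_of_mul_le_mul_left ?_ hf
  linarith

/-- The size of the error bound, up to a constant and a power of `l`. -/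
theorem gammaFactor_mul_gegenbauerBound_le {α : ℝ} (hα : -1 / 2 < α) :
    ∃ K : ℝ, 0 < K ∧ ∃ N : ℕ, 1 ≤ N ∧ ∀ n : ℕ, N ≤ n →
      gammaFactor α n * gegenbauerBound α n ≤
        K * ((n : ℝ) ^ (max α 0) / (n * n.factorial)) := by
  have h2 := Real.Gamma_pos_of_pos (s := 2 * α + 1) (by linarith)
  have h4 := Real.Gamma_pos_of_pos (s := α + 1) (by linarith)
  obtain ⟨N₁, hN₁⟩ := Gamma_natCast_add_bounds (s := α) (by linarith)
  rcases le_or_gt 0 α with h0 | h0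
  · obtain ⟨N₂, hN₂⟩ := Gamma_natCast_add_bounds (s := 2 * α) (by linarith)
    refine ⟨4 * (Real.Gamma (α + 1) / Real.Gamma (2 * α + 1)), by positivity,
      max 1 (max N₁ N₂), le_max_left _ _, fun n hn => ?_⟩
    simp only [max_le_iff] at hn
    have hn' : (0 : ℝ) < n := by exact_mod_cast hn.1
    have hf : (0 : ℝ) < n.factorial := by positivity
    have b1 := (hN₁ n hn.2.1).1
    have b2 := (hN₂ n hn.2.2).2
    have hp : 0 < (n : ℝ) ^ α := by positivity
    rw [gegenbauerBound, if_pos h0, mul_one, max_eq_left h0, gammaFactor, Gamma_natCast_add_two]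
    calc _ ≤ Real.Gamma (α + 1) * (2 * ((n : ℝ) ^ (2 * α) * n.factorial)) /
          (Real.Gamma (2 * α + 1) * (n * n.factorial) * ((n : ℝ) ^ α * n.factorial / 2)) := by
          gcongr
          · linarith
          · linarith
      _ = _ := by
          rw [two_mul α, Real.rpow_add hn']
          field_simp
          norm_num
  · obtain ⟨N₂, hN₂⟩ := abs_ring_choose_le (α := α) (by linarith)
    -- The 4 collects two factors 2 from the Gamma estimates. As ⌊n/2⌋ ≥ n/3 and α < 0, ⌊n/2⌋^α ≤
    -- (1/3)^α n^α, and this n^α cancels the one from Γ(n+α+1). The threshold `2 * N₂` ensures ⌊n/2⌋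
    -- ≥ `N₂`.
    refine ⟨4 * (1 / 3) ^ α, by positivity, max 3 (max N₁ (2 * N₂)), by simp, fun n hn => ?_⟩
    simp only [max_le_iff] at hn
    obtain ⟨hn3, hn1, hn2⟩ := hn
    have hn' : (0 : ℝ) < n := by exact_mod_cast (show 0 < n by omega)
    have hf : (0 : ℝ) < n.factorial := by positivity
    have hp : 0 < (n : ℝ) ^ α := by positivity
    have b1 := (hN₁ n hn1).1
    have b2 := hN₂ (n / 2) (by omega)
    have hm : 1 / 3 * (n : ℝ) ≤ ((n / 2 : ℕ) : ℝ) := by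
      have : (n : ℝ) ≤ 3 * ((n / 2 : ℕ) : ℝ) := by exact_mod_cast (show n ≤ 3 * (n / 2) by omega)
      linarith
    have b3 := Real.rpow_le_rpow_of_nonpos (by positivity) hm h0.le
    rw [Real.mul_rpow (by norm_num) hn'.le] at b3
    rw [max_eq_right h0.le, Real.rpow_zero]
    calc _ ≤ Real.Gamma (α + 1) / (n * Real.Gamma (n + α + 1)) *
          |Ring.choose (((n / 2 : ℕ) : ℝ) + α) (n / 2)| :=
          gammaFactor_mul_gegenbauerBound_le_choose hα h0 (by omega)
      _ ≤ Real.Gamma (α + 1) / (n * ((n : ℝ) ^ α * n.factorial / 2)) *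
          (2 / Real.Gamma (α + 1) * ((1 / 3) ^ α * (n : ℝ) ^ α)) := by
          gcongr
          · linarith
          · exact b2.trans (mul_le_mul_of_nonneg_left b3 (by positivity))
      _ = _ := by
          field_simp
          norm_num

theorem rpow_div_le {n : ℕ} (hn : 1 ≤ n) (a : ℝ) :
    (n : ℝ) ^ a / (n * n.factorial) ≤ Real.exp n / (n : ℝ) ^ ((n : ℝ) + 3 / 2 - a) := by
  have hn' : (0 : ℝ) < n := by exact_mod_cast hn
  have h := rpow_le_exp_mul_factorial hn
  rw [div_le_div_iff₀ (by positivity) (by positivity), ← Real.rpow_add hn',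
    show a + (n + 3 / 2 - a) = (n : ℝ) + 1 / 2 + 1 by ring, Real.rpow_add_one hn'.ne']
  calc _ ≤ Real.exp n * n.factorial * n := mul_le_mul_of_nonneg_right h hn'.le
    _ = _ := by ring

/-! ### Assembly of the error bounds. -/

theorem abs_bsgqError_le_gammaFactor {l α : ℝ} (hα : -1 / 2 < α) (hl : 0 < l) {n : ℕ}
    {f : ℝ → ℝ} {A : ℝ} (hA : 0 < A) (hf : DerivBound l n f A) (i : Fin (n + 1)) :
    |bsgqError l α n f i| ≤ A * sggNode l α n i * (l ^ (n + 1) / 2 ^ (2 * n + 1)) *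
      (gammaFactor α n * gegenbauerBound α n) := by
  refine (abs_bsgqError_le hα hl hA hf i fun x hx => abs_gegenbauer_le hα n hx).trans_eq ?_
  rw [errorFactor_eq hα]
  ring

theorem abs_bsgqError_le_exp_div {α : ℝ} (hα : -1 / 2 < α) :
    ∃ K : ℝ, 0 < K ∧ ∃ N : ℕ, ∀ n : ℕ, N ≤ n → ∀ l : ℝ, 0 < l →
      ∀ (f : ℝ → ℝ) (A : ℝ), 0 < A → DerivBound l n f A → ∀ i : Fin (n + 1),
        |bsgqError l α n f i| ≤ A * K * (Real.exp n * l ^ (n + 1) * sggNode l α n i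
          / ((2 : ℝ) ^ (2 * n + 1) * (n : ℝ) ^ ((n : ℝ) + 3 / 2 - max α 0))) := by
  obtain ⟨K, hK, N, hN1, hN⟩ := gammaFactor_mul_gegenbauerBound_le hα
  refine ⟨K, hK, N, fun n hn l hl f A hA hf i => ?_⟩
  have hx := ((sggNodes hα hl n).2 i).1.1
  refine (abs_bsgqError_le_gammaFactor hα hl hA hf i).trans ?_
  calc _ ≤ A * sggNode l α n i * (l ^ (n + 1) / 2 ^ (2 * n + 1)) *
        (K * (Real.exp n / (n : ℝ) ^ ((n : ℝ) + 3 / 2 - max α 0))) :=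
        mul_le_mul_of_nonneg_left ((hN n hn).trans
          (mul_le_mul_of_nonneg_left (rpow_div_le (hN1.trans hn) _) hK.le)) (by positivity)
    _ = _ := by ring

theorem abs_bsgqError_le_geometric {l α : ℝ} (hα : -1 / 2 < α) (hl : 0 < l) :
    ∃ c : ℝ, 0 < c ∧ ∀ (n : ℕ) (f : ℝ → ℝ) (A : ℝ), 0 < A → DerivBound l n f A →
      ∀ i : Fin (n + 1), |bsgqError l α n f i| ≤ A * c * (1 / 2) ^ n := by
  obtain ⟨K, hK, N, hN1, hN⟩ := gammaFactor_mul_gegenbauerBound_le hα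
  -- The bound with x_i replaced by l, divided by A (1/2)^n. It tends to 0, hence is bounded over
  -- all n, including those below `N`. The ratio 1/2 is arbitrary.
  set u : ℕ → ℝ := fun n => l * (l ^ (n + 1) / 2 ^ (2 * n + 1)) *
      (gammaFactor α n * gegenbauerBound α n) * 2 ^ n with hu
  have hpos : ∀ n, 0 ≤ gammaFactor α n * gegenbauerBound α n := fun n =>
    mul_nonneg (gammaFactor_pos hα n).le (zero_le_one.trans (one_le_gegenbauerBound hα n))
  have hlim : Filter.Tendsto u Filter.atTop (nhds 0) := by
    have h0 := (FloorSemiring.tendsto_pow_div_factorial_atTop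
      (l / 2 * Real.exp (max α 0))).const_mul (K * l ^ 2)
    rw [mul_zero] at h0
    refine squeeze_zero' (Filter.Eventually.of_forall fun n => ?_)
      (Filter.eventually_atTop.2 ⟨N, fun n hn => ?_⟩) h0
    · have := hpos n
      simp only [hu]
      positivity
    · have hn' : (1 : ℝ) ≤ n := by exact_mod_cast hN1.trans hn
      -- From log n ≤ n - 1: the power of n becomes geometric, to be beaten by n!.
      have h1 : (n : ℝ) ^ (max α 0) ≤ Real.exp (max α 0) ^ n := by
        rw [← Real.exp_nat_mul, Real.rpow_def_of_pos (by linarith)]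
        exact Real.exp_le_exp.2 (mul_le_mul_of_nonneg_right
          ((Real.log_le_sub_one_of_pos (by linarith)).trans (by linarith)) (le_max_right _ _))
      have h2 : (n : ℝ) ^ (max α 0) / (n * n.factorial) ≤
          Real.exp (max α 0) ^ n / n.factorial := by
        refine div_le_div₀ (by positivity) h1 (by positivity) ?_
        exact le_mul_of_one_le_left (by positivity) hn'
      calc u n ≤ l * (l ^ (n + 1) / 2 ^ (2 * n + 1)) *
            (K * (Real.exp (max α 0) ^ n / n.factorial)) * 2 ^ n := by
            refine mul_le_mul_of_nonneg_right (mul_le_mul_of_nonneg_left ((hN n hn).trans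
              (mul_le_mul_of_nonneg_left h2 hK.le)) (by positivity)) (by positivity)
        _ = K * l ^ 2 * ((l / 2 * Real.exp (max α 0)) ^ n / n.factorial) / 2 := by
            rw [mul_pow, div_pow, show (2 : ℝ) ^ (2 * n + 1) = 2 ^ n * 2 ^ n * 2 by ring,
              pow_succ l n]
            field_simp
        _ ≤ _ := half_le_self (by positivity)
  obtain ⟨c, hc⟩ := hlim.bddAbove_range
  refine ⟨max c 1, by positivity, fun n f A hA hf i => ?_⟩
  obtain ⟨hx0, hx1⟩ := ((sggNodes hα hl n).2 i).1
  refine (abs_bsgqError_le_gammaFactor hα hl hA hf i).trans ?_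
  have hp := hpos n
  calc _ ≤ A * l * (l ^ (n + 1) / 2 ^ (2 * n + 1)) *
        (gammaFactor α n * gegenbauerBound α n) := by gcongr
    _ = A * u n * (1 / 2) ^ n := by
        simp only [hu, one_div, inv_pow]
        field_simp
    _ ≤ _ := by
        have : u n ≤ max c 1 := (hc ⟨n, rfl⟩).trans (le_max_left _ _)
        gcongr

theorem mainTheorem2 (α : ℝ) (hα : -1 / 2 < α) :
    (∀ l : ℝ, 0 < l → ∀ (n : ℕ) (f : ℝ → ℝ) (A : ℝ), 0 < A → DerivBound l n f A →
      ∀ i : Fin (n + 1),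
        (0 ≤ α →
          |bsgqError l α n f i| ≤
            A * (2 : ℝ) ^ (-2 * (n : ℤ) - 1) * Real.Gamma (α + 1) * sggNode l α n i * l ^ (n + 1)
                * Real.Gamma (n + 2 * α + 1)
              / (Real.Gamma (2 * α + 1) * Real.Gamma (n + 2) * Real.Gamma (n + α + 1))) ∧
        (Odd n → α < 0 →
          |bsgqError l α n f i| ≤
            A * (2 : ℝ) ^ (-2 * (n : ℤ) - 1) * Real.Gamma (α + 1) * sggNode l α n i * l ^ (n + 1)
                * Real.Gamma (n + 2 * α + 1)
              / (Real.Gamma (2 * α + 1) * Real.Gamma (n + 2) * Real.Gamma (n + α + 1))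
              * (((n + 1).factorial : ℝ) * |Real.Gamma (2 * α)| / Real.Gamma (n + 2 * α + 1)
                * |Ring.choose (((n : ℝ) + 1) / 2 + α - 1) ((n + 1) / 2)|)) ∧
        (Even n → α < 0 →
          |bsgqError l α n f i| <
            A * (2 : ℝ) ^ (-2 * (n : ℤ) - 1) * |Real.Gamma α| * |α| * sggNode l α n i * l ^ (n + 1)
              / (Real.sqrt (((n : ℝ) + 1) * (2 * α + n + 1)) * Real.Gamma (n + α + 1))
              * |Ring.choose ((n : ℝ) / 2 + α) (n / 2)|)) ∧
    (∃ D₁ D₂ : ℝ, 0 < D₁ ∧ 0 < D₂ ∧ ∃ N : ℕ,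
      ∀ n : ℕ, N ≤ n → ∀ l : ℝ, 0 < l → ∀ (f : ℝ → ℝ) (A : ℝ), 0 < A → DerivBound l n f A →
        ∀ i : Fin (n + 1),
          (0 ≤ α →
            |bsgqError l α n f i| ≤
              A * D₁ * (Real.exp n * l ^ (n + 1) * sggNode l α n i
                / ((2 : ℝ) ^ (2 * n + 1) * (n : ℝ) ^ ((n : ℝ) + 3 / 2 - α)))) ∧
          (α < 0 →
            |bsgqError l α n f i| ≤
              A * D₁ * D₂ * (Real.exp n * l ^ (n + 1) * sggNode l α n i
                / ((2 : ℝ) ^ (2 * n + 1) * (n : ℝ) ^ ((n : ℝ) + 3 / 2))))) ∧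
    (∀ l : ℝ, 0 < l → ∃ c ρ : ℝ, 0 < c ∧ 0 < ρ ∧ ρ < 1 ∧
      ∀ (n : ℕ) (f : ℝ → ℝ) (A : ℝ), 0 < A → DerivBound l n f A → ∀ i : Fin (n + 1),
        |bsgqError l α n f i| ≤ A * c * ρ ^ n) := by

  refine ⟨fun l hl n f A hA hf i => ⟨fun h0 => ?_, fun hn h0 => ?_, fun hn h0 => ?_⟩, ?_,
    fun l hl => ?_⟩
  · have h := abs_bsgqError_le_gammaFactor hα hl hA hf i
    rw [gegenbauerBound, if_pos h0, gammaFactor] at h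
    refine h.trans_eq ?_
    rw [two_zpow_eq]
    ring
  · have h := abs_bsgqError_le_gammaFactor hα hl hA hf i
    rw [gegenbauerBound_of_odd hα h0 hn, gammaFactor] at h
    refine h.trans_eq ?_
    rw [two_zpow_eq]
    ring
  · have h := abs_bsgqError_lt hα hl hA hf i
      (zero_lt_one.trans_le (one_le_gegenbauerBound hα n)) fun x hx => abs_gegenbauer_le hα n hx
    refine h.trans_eq ?_
    -- Γ(α+1) = |Γ(α)| |α| turns the bound into the stated form.
    have hG := congrArg abs (Real.Gamma_add_one h0.ne)
    rw [abs_of_pos (Real.Gamma_pos_of_pos (by linarith)), abs_mul] at hG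
    rw [errorFactor_eq hα, two_zpow_eq]
    have he := gammaFactor_mul_gegenbauerBound_of_even hα h0 hn
    rw [hG] at he
    linear_combination A * (l ^ (n + 1) / 2 ^ (2 * n + 1)) * sggNode l α n i * he
  · obtain ⟨K, hK, N, hN⟩ := abs_bsgqError_le_exp_div hα
    -- `K` already covers either sign of α, so D₂ = 1 suffices.
    refine ⟨K, 1, hK, one_pos, N, fun n hn l hl f A hA hf i => ⟨fun h0 => ?_, fun h0 => ?_⟩⟩
    · have h := hN n hn l hl f A hA hf i
      rwa [max_eq_left h0] at h
    · have h := hN n hn l hl f A hA hf i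
      rwa [max_eq_right h0.le, sub_zero, ← mul_one (A * K)] at h
  · obtain ⟨c, hc, h⟩ := abs_bsgqError_le_geometric hα hl
    exact ⟨c, 1 / 2, hc, by norm_num, by norm_num, h⟩
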